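/- Let $n\ge 1$, $v\in\mathbb C$, $v\neq 0$, and let $g:\mathbb Z/n\mathbb Z\to\mathbb C$ satisfy $g(0)=-v$ and $g(a)g(-a)=v$ for $a\neq 0$. Let $V_\Gamma$ be the complex vector space with basis $+_a$ ($a\in\mathbb Z/n\mathbb Z$) and $-$, and let $V_\Delta$ be the one with basis $-_a$ ($a\in\mathbb Z/n\mathbb Z$) and $+$ (an edge carries a spin $\pm$ and a charge mod $n$; the undecorated spin has charge $0$). For $X,Y\in\{\Gamma,\Delta\}$ and $z_1,z_2\in\mathbb C^\times$ let $R^{XY}=R^{XY}(z_1,z_2)\in\operatorname{End}(V_X\otimes V_Y)$ be $$R^{XY}(x\otimes y)=\sum_{x',y'} w^{XY}(x,y;x',y')\,x'\otimes y' ,$$ the sum being over basis vectors $x'$ of $V_X$ and $y'$ of $V_Y$, where the Boltzmann weights $w^{XY}$ are as follows, and every weight not listed is $0$. Write $\bar a\in\{1,\dots,n\}$ for the representative of $a\in\mathbb Z/n\mathbb Z$ in that range and $[a]\in\{0,\dots,n-1\}$ for the one in that range. $\Gamma\Gamma$ (with $a\ne b$): $w(+_a,+_a;+_a,+_a)=z_2^n-vz_1^n$;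 $w(+_b,+_a;+_b,+_a)=g(a-b)(z_1^n-z_2^n)$; $w(+_b,+_a;+_a,+_b)=(1-v)z_1^{[a-b]}z_2^{n-[a-b]}$; $w(-,-;-,-)=z_1^n-vz_2^n$; $w(+_a,-;+_a,-)=v(z_1^n-z_2^n)$; $w(-,+_a;-,+_a)=z_1^n-z_2^n$; $w(-,+_a;+_a,-)=(1-v)z_1^{\bar a}z_2^{n-\bar a}$; $w(+_a,-;-,+_a)=(1-v)z_1^{n-\bar a}z_2^{\bar a}$. $\Delta\Delta$ (with $a\ne b$): $w(+,+;+,+)=z_1^n-vz_2^n$; $w(-_a,-_b;-_b,-_a)=(1-v)z_1^{n-[a-b]}z_2^{[a-b]}$; $w(-_a,-_b;-_a,-_b)=g(a-b)(z_1^n-z_2^n)$; $w(-_a,-_a;-_a,-_a)=z_2^n-vz_1^n$; $w(+,-_a;+,-_a)=v(z_1^n-z_2^n)$; $w(-_a,+;-_a,+)=z_1^n-z_2^n$; $w(-_a,+;+,-_a)=(1-v)z_1^{n-\bar a+1}z_2^{\bar a-1}$; $w(+,-_a;-_a,+)=(1-v)z_1^{\bar a-1}z_2^{n-\bar a+1}$.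 $\Gamma\Delta$: $w(+_a,+;+_a,+)=w(-,-_a;-,-_a)=z_1^n-vz_2^n$; $w(-,+;-,+)=z_1^n-z_2^n$; $w(+_a,-_b;+_a,-_b)=v^2z_2^n-z_1^n$ if $a+b=1$, and $=g(a+b-1)(z_1^n-vz_2^n)$ if $a+b\ne1$; if $a+b=c+d=1$ and $a\neq c$, then $w(+_a,-_b;+_c,-_d)$ is $(v-1)z_1^{n-e}z_2^{e}$ when $\bar a>\bar c$ and $v(v-1)z_1^{n-e}z_2^{e}$ when $\bar a<\bar c$, where $e=[a-c]$; if $a+b=1$, then $w(-,+;+_a,-_b)=(1-v)z_1^{\bar a}z_2^{\bar b-1}$ and $w(+_b,-_a;-,+)=(1-v)z_1^{\bar a-1}z_2^{\bar b}$. $\Delta\Gamma$: $w(+,+_a;+,+_a)=w(-_a,-;-_a,-)=z_2^n-v^nz_1^n$; $w(+,-;+,-)=z_2^n-v^{n+1}z_1^n$; $w(-_a,+_b;-_a,+_b)=v^{n-1}z_1^n-z_2^n$ if $a+b=1$, and $=(z_2^n-v^nz_1^n)/g(a+b-1)$ if $a+b\neq1$; if $a+b=c+d=1$ and $a\ne c$,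 then $w(-_a,+_b;-_c,+_d)=(1-v)v^{e-1}z_1^{e}z_2^{n-e}$, where $e=[c-a]$; if $a+b=1$, then $w(-_b,+_a;+,-)=(1-v)v^{\bar a-1}z_1^{\bar a}z_2^{\bar b-1}$ and $w(+,-;-_a,+_b)=(1-v)v^{\bar a-1}z_1^{\bar a-1}z_2^{\bar b}$. For parametrized endomorphisms $A\in\operatorname{End}(U\otimes V)$, $B\in\operatorname{End}(U\otimes W)$, $C\in\operatorname{End}(V\otimes W)$ put $$\llbracket A,B,C\rrbracket=A_{12}(z_1,z_2)B_{13}(z_1,z_3)C_{23}(z_2,z_3)-C_{23}(z_2,z_3)B_{13}(z_1,z_3)A_{12}(z_1,z_2)\in\operatorname{End}(U\otimes V\otimes W),$$ where the subscripts indicate the tensor factors acted upon, and put $A^\ddagger(z_1,z_2)=\tau A(z_2,z_1)\tau$, where $\tau(x\otimes y)=y\otimes x$. **Theorem.** (i) The endomorphism $R^{\Delta\Gamma}(z_1,z_2)$ is invertible whenever $z_2^n\ne v^nz_1^n$ and $z_2^n\neq vz_1^n$. (ii) Let $A=R^{\Gamma\Gamma}$, $B=(R^{\Delta\Gamma})^{-1}$,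 $C=R^{\Gamma\Delta}$, $D=(R^{\Delta\Delta})^\ddagger$. Then $A,B,C,D$ form a parametrized Yang–Baxter system: for all $z_1,z_2,z_3\in\mathbb C^\times$ for which the inverses that occur exist, $$\llbracket A,A,A\rrbracket=0,\quad \llbracket A,C,C\rrbracket=0,\quad \llbracket A,B^\ddagger,B^\ddagger\rrbracket=0,\quad \llbracket A,C,B^\ddagger\rrbracket=0,$$ $$\llbracket D,D,D\rrbracket=0,\quad \llbracket D,B,B\rrbracket=0,\quad \llbracket D,C^\ddagger,C^\ddagger\rrbracket=0,\quad \llbracket D,B,C^\ddagger\rrbracket=0.$$ (iii) There is a scalar $c(z_1,z_2)$, depending only on $z_1,z_2$ (and on $n,v,g$), such that for all $z_1,z_2\in\mathbb C^\times$ for which $R^{\Delta\Gamma}(z_1,z_2)$ is invertible, $c(z_1,z_2)\neq0$ and $$(R^{\Gamma\Delta})^\ddagger(z_1,z_2)=c(z_1,z_2)\,(R^{\Delta\Gamma}(z_1,z_2))^{-1}.$$ -/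

import Mathlib

open scoped Matrix

/-- Decorated horizontal edges of Gamma ice of nonzero weight: spin `+` with any charge mod `n`,
or spin `-` with charge `0`. They index the basis of the `(n+1)`-dimensional space `V_Γ`. -/
inductive GammaEdge (n : ℕ) : Type
  | plus (a : ZMod n)
  | minus
  deriving DecidableEq

/-- Decorated horizontal edges of Delta ice of nonzero weight: spin `-` with any charge mod `n`,
or spin `+` with charge `0`. They index the basis of the `(n+1)`-dimensional space `V_Δ`. -/
inductive DeltaEdge (n : ℕ) : Type
  | minus (a : ZMod n)
  | plus
  deriving DecidableEq

def GammaEdge.equivOption (n : ℕ) : Option (ZMod n) ≃ GammaEdge n where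
  toFun x := match x with
    | some a => .plus a
    | none => .minus
  invFun e := match e with
    | .plus a => some a
    | .minus => none
  left_inv x := by cases x <;> rfl
  right_inv e := by cases e <;> rfl

def DeltaEdge.equivOption (n : ℕ) : Option (ZMod n) ≃ DeltaEdge n where
  toFun x := match x with
    | some a => .minus a
    | none => .plus
  invFun e := match e with
    | .minus a => some a
    | .plus => none
  left_inv x := by cases x <;> rfl
  right_inv e := by cases e <;> rfl

instance GammaEdge.instFintype (n : ℕ) [NeZero n] : Fintype (GammaEdge n) :=
  Fintype.ofEquiv (Option (ZMod n)) (GammaEdge.equivOption n)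

instance DeltaEdge.instFintype (n : ℕ) [NeZero n] : Fintype (DeltaEdge n) :=
  Fintype.ofEquiv (Option (ZMod n)) (DeltaEdge.equivOption n)

/-- The representative in `[1, n]` of a charge mod `n`. (`ZMod.val` is the one in `[0, n - 1]`.) -/
def posRep {n : ℕ} (a : ZMod n) : ℕ := if a = 0 then n else a.val

/-! ### Boltzmann weights of the tilted vertices

In `weightXY v g z₁ z₂ sw nw ne se` the southwest and northeast edges are of type `X` (with
parameter `z₁`), the northwest and southeast edges are of type `Y` (with parameter `z₂`). -/

/-- Weights of `ΓΓ` vertices. -/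
noncomputable def weightGammaGamma {n : ℕ} (v : ℂ) (g : ZMod n → ℂ) (z₁ z₂ : ℂ) :
    GammaEdge n → GammaEdge n → GammaEdge n → GammaEdge n → ℂ
  | .plus b, .plus a, .plus c, .plus d =>
      if a = b then
        if c = a ∧ d = a then z₂ ^ n - v * z₁ ^ n else 0
      else if c = b ∧ d = a then g (a - b) * (z₁ ^ n - z₂ ^ n)
      else if c = a ∧ d = b then (1 - v) * z₁ ^ (a - b).val * z₂ ^ (n - (a - b).val)
      else 0
  | .minus, .minus, .minus, .minus => z₁ ^ n - v * z₂ ^ n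
  | .plus a, .minus, .plus c, .minus => if a = c then v * (z₁ ^ n - z₂ ^ n) else 0
  | .minus, .plus a, .minus, .plus d => if a = d then z₁ ^ n - z₂ ^ n else 0
  | .minus, .plus a, .plus c, .minus =>
      if a = c then (1 - v) * z₁ ^ posRep a * z₂ ^ (n - posRep a) else 0
  | .plus a, .minus, .minus, .plus d =>
      if a = d then (1 - v) * z₁ ^ (n - posRep a) * z₂ ^ posRep a else 0
  | _, _, _, _ => 0

/-- Weights of `ΔΔ` vertices. -/
noncomputable def weightDeltaDelta {n : ℕ} (v : ℂ) (g : ZMod n → ℂ) (z₁ z₂ : ℂ) :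
    DeltaEdge n → DeltaEdge n → DeltaEdge n → DeltaEdge n → ℂ
  | .plus, .plus, .plus, .plus => z₁ ^ n - v * z₂ ^ n
  | .minus a, .minus b, .minus c, .minus d =>
      if a = b then
        if c = a ∧ d = a then z₂ ^ n - v * z₁ ^ n else 0
      else if c = b ∧ d = a then (1 - v) * z₁ ^ (n - (a - b).val) * z₂ ^ (a - b).val
      else if c = a ∧ d = b then g (a - b) * (z₁ ^ n - z₂ ^ n)
      else 0
  | .plus, .minus a, .plus, .minus d => if a = d then v * (z₁ ^ n - z₂ ^ n) else 0
  | .minus a, .plus, .plus, .minus d =>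
      if a = d then (1 - v) * z₁ ^ (n - posRep a + 1) * z₂ ^ (posRep a - 1) else 0
  | .minus a, .plus, .minus c, .plus => if a = c then z₁ ^ n - z₂ ^ n else 0
  | .plus, .minus a, .minus c, .plus =>
      if a = c then (1 - v) * z₁ ^ (posRep a - 1) * z₂ ^ (n - posRep a + 1) else 0
  | _, _, _, _ => 0

/-- Weights of `ΓΔ` vertices. In the case `a + b ≡ c + d ≡ 1`, `a ≢ c`, the weight depends on
whether `ad = 0`, or `abcd ≠ 0` and `a > c` (representatives in `[0, n - 1]`); as `d = 0` means
`c = 1`, this says that the representative of `a` in `[1, n]` exceeds that of `c`. -/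
noncomputable def weightGammaDelta {n : ℕ} (v : ℂ) (g : ZMod n → ℂ) (z₁ z₂ : ℂ) :
    GammaEdge n → DeltaEdge n → GammaEdge n → DeltaEdge n → ℂ
  | .plus a, .plus, .plus c, .plus => if a = c then z₁ ^ n - v * z₂ ^ n else 0
  | .minus, .minus a, .minus, .minus d => if a = d then z₁ ^ n - v * z₂ ^ n else 0
  | .plus a, .minus b, .plus c, .minus d =>
      if a = c ∧ b = d then
        if a + b = 1 then v ^ 2 * z₂ ^ n - z₁ ^ n
        else g (a + b - 1) * (z₁ ^ n - v * z₂ ^ n)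
      else if a + b = 1 ∧ c + d = 1 then
        if posRep c < posRep a then (v - 1) * z₁ ^ (n - (a - c).val) * z₂ ^ (a - c).val
        else v * (v - 1) * z₁ ^ (n - (a - c).val) * z₂ ^ (a - c).val
      else 0
  | .minus, .plus, .minus, .plus => z₁ ^ n - z₂ ^ n
  | .minus, .plus, .plus a, .minus b =>
      if a + b = 1 then (1 - v) * z₁ ^ posRep a * z₂ ^ (posRep b - 1) else 0
  | .plus b, .minus a, .minus, .plus =>
      if a + b = 1 then (1 - v) * z₁ ^ (posRep a - 1) * z₂ ^ posRep b else 0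
  | _, _, _, _ => 0

/-- Weights of `ΔΓ` vertices. -/
noncomputable def weightDeltaGamma {n : ℕ} (v : ℂ) (g : ZMod n → ℂ) (z₁ z₂ : ℂ) :
    DeltaEdge n → GammaEdge n → DeltaEdge n → GammaEdge n → ℂ
  | .plus, .plus a, .plus, .plus d => if a = d then z₂ ^ n - v ^ n * z₁ ^ n else 0
  | .minus a, .minus, .minus c, .minus => if a = c then z₂ ^ n - v ^ n * z₁ ^ n else 0
  | .plus, .minus, .plus, .minus => z₂ ^ n - v ^ (n + 1) * z₁ ^ n
  | .minus a, .plus b, .minus c, .plus d =>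
      if a = c ∧ b = d then
        if a + b = 1 then v ^ (n - 1) * z₁ ^ n - z₂ ^ n
        else (z₂ ^ n - v ^ n * z₁ ^ n) / g (a + b - 1)
      else if a + b = 1 ∧ c + d = 1 then
        (1 - v) * v ^ ((c - a).val - 1) * z₁ ^ (c - a).val * z₂ ^ (n - (c - a).val)
      else 0
  | .minus b, .plus a, .plus, .minus =>
      if a + b = 1 then (1 - v) * v ^ (posRep a - 1) * z₁ ^ posRep a * z₂ ^ (posRep b - 1) else 0
  | .plus, .minus, .minus a, .plus b =>
      if a + b = 1 then (1 - v) * v ^ (posRep a - 1) * z₁ ^ (posRep a - 1) * z₂ ^ posRep b else 0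
  | _, _, _, _ => 0

/-! ### The R-matrices

A square matrix indexed by `ι × κ` is an endomorphism of `ℂ^ι ⊗ ℂ^κ`. The column of `R^{XY}` is
(southwest, northwest), the row is (northeast, southeast). -/

noncomputable def RGammaGamma {n : ℕ} (v : ℂ) (g : ZMod n → ℂ) (z₁ z₂ : ℂˣ) :
    Matrix (GammaEdge n × GammaEdge n) (GammaEdge n × GammaEdge n) ℂ :=
  Matrix.of fun p q => weightGammaGamma v g z₁ z₂ q.1 q.2 p.1 p.2

noncomputable def RDeltaDelta {n : ℕ} (v : ℂ) (g : ZMod n → ℂ) (z₁ z₂ : ℂˣ) :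
    Matrix (DeltaEdge n × DeltaEdge n) (DeltaEdge n × DeltaEdge n) ℂ :=
  Matrix.of fun p q => weightDeltaDelta v g z₁ z₂ q.1 q.2 p.1 p.2

noncomputable def RGammaDelta {n : ℕ} (v : ℂ) (g : ZMod n → ℂ) (z₁ z₂ : ℂˣ) :
    Matrix (GammaEdge n × DeltaEdge n) (GammaEdge n × DeltaEdge n) ℂ :=
  Matrix.of fun p q => weightGammaDelta v g z₁ z₂ q.1 q.2 p.1 p.2

noncomputable def RDeltaGamma {n : ℕ} (v : ℂ) (g : ZMod n → ℂ) (z₁ z₂ : ℂˣ) :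
    Matrix (DeltaEdge n × GammaEdge n) (DeltaEdge n × GammaEdge n) ℂ :=
  Matrix.of fun p q => weightDeltaGamma v g z₁ z₂ q.1 q.2 p.1 p.2

/-! ### Yang-Baxter systems -/

/-- Parametrized endomorphisms of `ℂ^ι ⊗ ℂ^κ`. -/
abbrev ParamEnd (ι κ : Type) : Type := ℂˣ → ℂˣ → Matrix (ι × κ) (ι × κ) ℂ

/-- `A₁₂`: the endomorphism `A` on the first two tensor factors, the identity on the third. -/
def act12 {ι κ μ : Type} [DecidableEq μ] (A : Matrix (ι × κ) (ι × κ) ℂ) :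
    Matrix (ι × κ × μ) (ι × κ × μ) ℂ :=
  Matrix.of fun p q => if p.2.2 = q.2.2 then A (p.1, p.2.1) (q.1, q.2.1) else 0

/-- `B₁₃`: the endomorphism `B` on the outer tensor factors, the identity on the second. -/
def act13 {ι κ μ : Type} [DecidableEq κ] (B : Matrix (ι × μ) (ι × μ) ℂ) :
    Matrix (ι × κ × μ) (ι × κ × μ) ℂ :=
  Matrix.of fun p q => if p.2.1 = q.2.1 then B (p.1, p.2.2) (q.1, q.2.2) else 0

/-- `C₂₃`: the endomorphism `C` on the last two tensor factors, the identity on the first. -/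
def act23 {ι κ μ : Type} [DecidableEq ι] (C : Matrix (κ × μ) (κ × μ) ℂ) :
    Matrix (ι × κ × μ) (ι × κ × μ) ℂ :=
  Matrix.of fun p q => if p.1 = q.1 then C p.2 q.2 else 0

/-- The Yang-Baxter commutator `⟦A, B, C⟧` at the parameters `z₁, z₂, z₃`. -/
def ybCommutator {ι κ μ : Type} [Fintype ι] [Fintype κ] [Fintype μ]
    [DecidableEq ι] [DecidableEq κ] [DecidableEq μ]
    (A : ParamEnd ι κ) (B : ParamEnd ι μ) (C : ParamEnd κ μ) (z₁ z₂ z₃ : ℂˣ) :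
    Matrix (ι × κ × μ) (ι × κ × μ) ℂ :=
  act12 (A z₁ z₂) * act13 (B z₁ z₃) * act23 (C z₂ z₃)
    - act23 (C z₂ z₃) * act13 (B z₁ z₃) * act12 (A z₁ z₂)

/-- The flip operator `x ⊗ y ↦ y ⊗ x`. -/
def flipOp (ι κ : Type) [DecidableEq ι] [DecidableEq κ] : Matrix (κ × ι) (ι × κ) ℂ :=
  Matrix.of fun p q => if p = q.swap then 1 else 0

/-- `A^‡(z₁, z₂) = τ A(z₂, z₁) τ`. -/
def ddagger {ι κ : Type} [Fintype ι] [Fintype κ] [DecidableEq ι] [DecidableEq κ]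
    (A : ParamEnd ι κ) : ParamEnd κ ι :=
  fun z₁ z₂ => flipOp ι κ * A z₂ z₁ * flipOp κ ι

/-- `A, B, C, D` form a parametrized Yang-Baxter system. -/
structure IsYangBaxterSystem {ι κ : Type} [Fintype ι] [Fintype κ] [DecidableEq ι] [DecidableEq κ]
    (A : ParamEnd ι ι) (B : ParamEnd κ ι) (C : ParamEnd ι κ) (D : ParamEnd κ κ) : Prop where
  aaa : ∀ z₁ z₂ z₃, ybCommutator A A A z₁ z₂ z₃ = 0
  acc : ∀ z₁ z₂ z₃, ybCommutator A C C z₁ z₂ z₃ = 0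
  abb : ∀ z₁ z₂ z₃, ybCommutator A (ddagger B) (ddagger B) z₁ z₂ z₃ = 0
  acb : ∀ z₁ z₂ z₃, ybCommutator A C (ddagger B) z₁ z₂ z₃ = 0
  ddd : ∀ z₁ z₂ z₃, ybCommutator D D D z₁ z₂ z₃ = 0
  dbb : ∀ z₁ z₂ z₃, ybCommutator D B B z₁ z₂ z₃ = 0
  dcc : ∀ z₁ z₂ z₃, ybCommutator D (ddagger C) (ddagger C) z₁ z₂ z₃ = 0
  dbc : ∀ z₁ z₂ z₃, ybCommutator D B (ddagger C) z₁ z₂ z₃ = 0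

/-!
Up to a diagonal change of basis that depends on the parameters, `R^{ΓΓ}` and `(R^{ΔΔ})^‡` are
twisted Perk-Schultz R-matrices, that is, Baxterized solutions of the Hecke and braid relations;
this gives their Yang-Baxter equations. Up to diagonal twists, `R^{ΓΔ}` is the crossing of `R^{ΓΓ}`,
namely its partial transpose with one parameter multiplied by an `n`-th root `u` of `v`, and
`(R^{ΓΔ})^‡` is the crossing of `(R^{ΔΔ})^‡` with `u⁻¹` for `u`. Crossing permutes the factors of a
Yang-Baxter equation, whence the mixed equations that involve `R^{ΓΔ}`. Finally, a telescoping sum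
shows that `R^{ΔΓ} (R^{ΓΔ})^‡` is the scalar `(z₂ⁿ - v z₁ⁿ) (z₂ⁿ - vⁿ z₁ⁿ)`, so that the equations
that involve the inverse of `R^{ΔΓ}` are the same equations up to a scalar.
-/

/-! ### Parametrized Yang-Baxter equations -/

/-- The parametrized Yang-Baxter equation `A₁₂ B₁₃ C₂₃ = C₂₃ B₁₃ A₁₂`, for all parameters. -/
def SatisfiesYBE {ι κ μ : Type} [Fintype ι] [Fintype κ] [Fintype μ] [DecidableEq ι]
    [DecidableEq κ] [DecidableEq μ] (A : ParamEnd ι κ) (B : ParamEnd ι μ) (C : ParamEnd κ μ) :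
    Prop :=
  ∀ z₁ z₂ z₃, ybCommutator A B C z₁ z₂ z₃ = 0

/-- The change of basis of `A` by diagonal matrices `d z`, `e z` that depend on the parameter
`z` of the tensor factor they act on. -/
def ParamEnd.gauge {ι κ : Type} (d : ℂˣ → ι → ℂˣ) (e : ℂˣ → κ → ℂˣ) (A : ParamEnd ι κ) :
    ParamEnd ι κ :=
  fun z₁ z₂ => Matrix.of fun p q =>
    (d z₁ p.1 * e z₂ p.2 : ℂ) * ↑(d z₁ q.1 * e z₂ q.2)⁻¹ * A z₁ z₂ p q

/-- The matrix `C`, multiplied on the left and on the right by diagonal matrices that act on the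
first tensor factor only. -/
def ParamEnd.twist {ι κ : Type} (x y : ι → ℂ) (C : ParamEnd ι κ) : ParamEnd ι κ :=
  fun z₁ z₂ => Matrix.of fun p q => x p.1 * y q.1 * C z₁ z₂ p q

/-- The partial transpose of the first tensor factor of `A`, carried over to a space `μ` in
duality with `ι` and put second, with its parameter shifted by `u`. -/
def ParamEnd.crossing {ι μ : Type} (u : ℂˣ) (ψ : μ ≃ ι) (A : ParamEnd ι ι) : ParamEnd ι μ :=
  fun z₁ z₂ => Matrix.of fun p q => A (u * z₂) z₁ (ψ q.2, p.1) (ψ p.2, q.1)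

theorem flipOp_mul_apply {ι κ μ : Type} [Fintype ι] [Fintype κ] [DecidableEq ι] [DecidableEq κ]
    (A : Matrix (ι × κ) μ ℂ) (p : κ × ι) (q : μ) : (flipOp ι κ * A) p q = A p.swap q := by
  have hswap (s : ι × κ) : p = s.swap ↔ s = p.swap := by grind [Prod.swap_swap]
  simp [flipOp, Matrix.mul_apply, hswap]

theorem ddagger_apply {ι κ : Type} [Fintype ι] [Fintype κ] [DecidableEq ι] [DecidableEq κ]
    (A : ParamEnd ι κ) (z₁ z₂ : ℂˣ) (p q : κ × ι) :
    ddagger A z₁ z₂ p q = A z₂ z₁ p.swap q.swap := by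
  rw [ddagger, Matrix.mul_assoc, flipOp_mul_apply]
  simp [flipOp, Matrix.mul_apply]

section YangBaxter

variable {ι κ μ : Type} [Fintype ι] [Fintype κ] [Fintype μ] [DecidableEq ι] [DecidableEq κ]
  [DecidableEq μ]

theorem act12_mul_act13_mul_act23_apply (A : Matrix (ι × κ) (ι × κ) ℂ)
    (B : Matrix (ι × μ) (ι × μ) ℂ) (C : Matrix (κ × μ) (κ × μ) ℂ) (p q : ι × κ × μ) :
    (act12 A * act13 B * act23 C : Matrix _ (ι × κ × μ) ℂ) p q =
      ∑ s : ι × κ × μ, A (p.1, p.2.1) (s.1, s.2.1) * B (s.1, p.2.2) (q.1, s.2.2) *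
        C (s.2.1, s.2.2) (q.2.1, q.2.2) := by
  simp only [Matrix.mul_apply, act12, act13, act23, Matrix.of_apply, Fintype.sum_prod_type,
    ite_mul, mul_ite, zero_mul, mul_zero, Finset.sum_ite_eq, Finset.sum_ite_eq',
    Finset.sum_ite_irrel, Finset.sum_const_zero, Finset.mem_univ, if_true, Finset.sum_mul]
  exact (Finset.sum_congr rfl fun _ _ => Finset.sum_comm).trans Finset.sum_comm

theorem act23_mul_act13_mul_act12_apply (A : Matrix (ι × κ) (ι × κ) ℂ)
    (B : Matrix (ι × μ) (ι × μ) ℂ) (C : Matrix (κ × μ) (κ × μ) ℂ) (p q : ι × κ × μ) :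
    (act23 C * act13 B * act12 A : Matrix _ (ι × κ × μ) ℂ) p q =
      ∑ s : ι × κ × μ, C (p.2.1, p.2.2) (s.2.1, s.2.2) * B (p.1, s.2.2) (s.1, q.2.2) *
        A (s.1, s.2.1) (q.1, q.2.1) := by
  simp only [Matrix.mul_apply, act12, act13, act23, Matrix.of_apply, Fintype.sum_prod_type,
    ite_mul, mul_ite, zero_mul, mul_zero, Finset.sum_ite_eq, Finset.sum_ite_eq',
    Finset.sum_ite_irrel, Finset.sum_const_zero, Finset.mem_univ, if_true, Finset.sum_mul]

theorem satisfiesYBE_iff_sum {A : ParamEnd ι κ} {B : ParamEnd ι μ} {C : ParamEnd κ μ} :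
    SatisfiesYBE A B C ↔ ∀ z₁ z₂ z₃ i j k i' j' k',
      ∑ s : ι × κ × μ, A z₁ z₂ (i, j) (s.1, s.2.1) * B z₁ z₃ (s.1, k) (i', s.2.2) *
          C z₂ z₃ (s.2.1, s.2.2) (j', k') =
        ∑ s : ι × κ × μ, C z₂ z₃ (j, k) (s.2.1, s.2.2) * B z₁ z₃ (i, s.2.2) (s.1, k') *
          A z₁ z₂ (s.1, s.2.1) (i', j') := by
  simp only [SatisfiesYBE, ybCommutator, sub_eq_zero, ← Matrix.ext_iff,
    act12_mul_act13_mul_act23_apply, act23_mul_act13_mul_act12_apply, Prod.forall]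

namespace SatisfiesYBE

variable {A : ParamEnd ι κ} {B : ParamEnd ι μ} {C : ParamEnd κ μ}

theorem smul_left (h : SatisfiesYBE A B C) (b : ℂˣ → ℂˣ → ℂ) :
    SatisfiesYBE A (fun z₁ z₂ => b z₁ z₂ • B z₁ z₂) C := by
  rw [satisfiesYBE_iff_sum] at h ⊢
  intro z₁ z₂ z₃ i j k i' j' k'
  convert congrArg (b z₁ z₃ * ·) (h z₁ z₂ z₃ i j k i' j' k') using 1 <;>
  · simp only [Finset.mul_sum, Matrix.smul_apply, smul_eq_mul]
    exact Finset.sum_congr rfl fun _ _ => by ring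

theorem smul_right (h : SatisfiesYBE A B C) (c : ℂˣ → ℂˣ → ℂ) :
    SatisfiesYBE A B (fun z₁ z₂ => c z₁ z₂ • C z₁ z₂) := by
  rw [satisfiesYBE_iff_sum] at h ⊢
  intro z₁ z₂ z₃ i j k i' j' k'
  convert congrArg (c z₂ z₃ * ·) (h z₁ z₂ z₃ i j k i' j' k') using 1 <;>
  · simp only [Finset.mul_sum, Matrix.smul_apply, smul_eq_mul]
    exact Finset.sum_congr rfl fun _ _ => by ring

theorem gauge (h : SatisfiesYBE A B C) (d : ℂˣ → ι → ℂˣ) (e : ℂˣ → κ → ℂˣ) (f : ℂˣ → μ → ℂˣ) :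
    SatisfiesYBE (A.gauge d e) (B.gauge d f) (C.gauge e f) := by
  rw [satisfiesYBE_iff_sum] at h ⊢
  intro z₁ z₂ z₃ i j k i' j' k'
  convert congrArg ((d z₁ i * e z₂ j * f z₃ k : ℂ) * ↑(d z₁ i' * e z₂ j' * f z₃ k')⁻¹ * ·)
    (h z₁ z₂ z₃ i j k i' j' k') using 1 <;>
  · simp only [Finset.mul_sum, ParamEnd.gauge, Matrix.of_apply]
    exact Finset.sum_congr rfl fun _ _ => by push_cast; field_simp

theorem twist (h : SatisfiesYBE A B C) {x y : ι → ℂ} {x' y' : κ → ℂ}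
    (hx : ∀ z₁ z₂ p q, A z₁ z₂ p q ≠ 0 → x p.1 * x' p.2 = x q.1 * x' q.2)
    (hy : ∀ z₁ z₂ p q, A z₁ z₂ p q ≠ 0 → y p.1 * y' p.2 = y q.1 * y' q.2) :
    SatisfiesYBE A (B.twist x y) (C.twist x' y') := by
  rw [satisfiesYBE_iff_sum] at h ⊢
  intro z₁ z₂ z₃ i j k i' j' k'
  convert congrArg ((x i * x' j) * (y i' * y' j') * ·) (h z₁ z₂ z₃ i j k i' j' k') using 1 <;>
    simp only [Finset.mul_sum, ParamEnd.twist, Matrix.of_apply] <;>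
    refine Finset.sum_congr rfl fun s _ => ?_
  · rcases eq_or_ne (A z₁ z₂ (i, j) (s.1, s.2.1)) 0 with hA | hA
    · simp only [hA, zero_mul, mul_zero]
    · rw [hx _ _ _ _ hA]
      ring
  · rcases eq_or_ne (A z₁ z₂ (s.1, s.2.1) (i', j')) 0 with hA | hA
    · simp only [hA, mul_zero]
    · rw [← hy _ _ _ _ hA]
      ring

theorem crossing {A : ParamEnd ι ι} (h : SatisfiesYBE A A A) (u : ℂˣ) (ψ : μ ≃ ι) :
    SatisfiesYBE A (A.crossing u ψ) (A.crossing u ψ) := by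
  rw [satisfiesYBE_iff_sum] at h ⊢
  intro z₁ z₂ z₃ i j k i' j' k'
  let rotate : ι × ι × μ ≃ ι × ι × ι :=
    { toFun := fun s => (ψ s.2.2, s.1, s.2.1)
      invFun := fun t => (t.2.1, t.2.2, ψ.symm t.1)
      left_inv := fun s => by simp
      right_inv := fun t => by simp }
  have key := (h (u * z₃) z₁ z₂ (ψ k') i j (ψ k) i' j').symm
  rw [← rotate.sum_comp, ← rotate.sum_comp] at key
  convert key using 1 <;> exact Finset.sum_congr rfl fun s _ => by
    simp only [ParamEnd.crossing, Matrix.of_apply, rotate, Equiv.coe_fn_mk]; ring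

end SatisfiesYBE

end YangBaxter

/-! ### Baxterized Hecke generators -/

section Baxterization

/-- The Baxterization of an element `T` that satisfies the Hecke relation `T² = (1 - v) T + v`: it
turns the braid relation into one with the spectral parameters `x`, `y`. -/
def baxterize {K R : Type*} [CommRing K] [Ring R] [Algebra K R] (v : K) (T : R) (x y : K) : R :=
  (y - x) • T + ((1 - v) * x) • 1

theorem baxterize_braid {K R : Type*} [CommRing K] [Ring R] [Algebra K R] {v : K} {T U : R}
    (hT : T * T = (1 - v) • T + v • 1) (hU : U * U = (1 - v) • U + v • 1)
    (hTU : T * U * T = U * T * U) (x y z : K) :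
    baxterize v U x y * baxterize v T x z * baxterize v U y z =
      baxterize v T y z * baxterize v U x z * baxterize v T x y := by
  simp only [baxterize, mul_add, add_mul, smul_mul_assoc, mul_smul_comm, mul_one, one_mul, hT,
    hU, ← hTU]
  module

variable {ι : Type} [DecidableEq ι]

theorem act12_smul_add_smul_one (T : Matrix (ι × ι) (ι × ι) ℂ) (a b : ℂ) :
    (act12 (a • T + b • 1) : Matrix (ι × ι × ι) _ ℂ) = a • act12 T + b • 1 := by
  ext ⟨i, j, k⟩ ⟨i', j', k'⟩
  by_cases hk : k = k' <;> simp [act12, Matrix.one_apply, hk]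

theorem act23_smul_add_smul_one (T : Matrix (ι × ι) (ι × ι) ℂ) (a b : ℂ) :
    (act23 (a • T + b • 1) : Matrix (ι × ι × ι) _ ℂ) = a • act23 T + b • 1 := by
  ext ⟨i, j, k⟩ ⟨i', j', k'⟩
  by_cases hi : i = i' <;> simp [act23, Matrix.one_apply, hi]

variable [Fintype ι]

theorem flipOp_mul_flipOp : flipOp ι ι * flipOp ι ι = 1 := by
  ext p q
  rw [flipOp_mul_apply]
  simp [flipOp, Matrix.one_apply]

theorem act12_mul (A B : Matrix (ι × ι) (ι × ι) ℂ) :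
    (act12 (A * B) : Matrix (ι × ι × ι) _ ℂ) = act12 A * act12 B := by
  ext p q
  simp [act12, Matrix.mul_apply, Fintype.sum_prod_type]

theorem act23_mul (A B : Matrix (ι × ι) (ι × ι) ℂ) :
    (act23 (A * B) : Matrix (ι × ι × ι) _ ℂ) = act23 A * act23 B := by
  ext p q
  simp [act23, Matrix.mul_apply, Fintype.sum_prod_type]

theorem act12_flipOp_mul_self :
    (act12 (flipOp ι ι) * act12 (flipOp ι ι) : Matrix (ι × ι × ι) _ ℂ) = 1 := by
  rw [← act12_mul, flipOp_mul_flipOp]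
  simpa using act12_smul_add_smul_one (ι := ι) 0 0 1

theorem act23_flipOp_mul_self :
    (act23 (flipOp ι ι) * act23 (flipOp ι ι) : Matrix (ι × ι × ι) _ ℂ) = 1 := by
  rw [← act23_mul, flipOp_mul_flipOp]
  simpa using act23_smul_add_smul_one (ι := ι) 0 0 1

theorem act13_eq_conj_act12 (A : Matrix (ι × ι) (ι × ι) ℂ) :
    (act13 A : Matrix (ι × ι × ι) _ ℂ) =
      act23 (flipOp ι ι) * act12 A * act23 (flipOp ι ι) := by
  ext p q
  simp [act12, act13, act23, flipOp, Matrix.mul_apply, Fintype.sum_prod_type, Prod.ext_iff,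
    ite_and]

theorem act13_eq_conj_act23 (A : Matrix (ι × ι) (ι × ι) ℂ) :
    (act13 A : Matrix (ι × ι × ι) _ ℂ) =
      act12 (flipOp ι ι) * act23 A * act12 (flipOp ι ι) := by
  ext p q
  simp [act12, act13, act23, flipOp, Matrix.mul_apply, Fintype.sum_prod_type, Prod.ext_iff,
    ite_and]

theorem act12_mul_act23_flipOp_mul_act12_flipOp (A : Matrix (ι × ι) (ι × ι) ℂ) :
    (act12 A * act23 (flipOp ι ι) * act12 (flipOp ι ι) : Matrix (ι × ι × ι) _ ℂ) =
      act23 (flipOp ι ι) * act12 (flipOp ι ι) * act23 A := by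
  have h := (act13_eq_conj_act12 A).symm.trans (act13_eq_conj_act23 A)
  calc _ = act23 (flipOp ι ι) * (act23 (flipOp ι ι) * act12 A * act23 (flipOp ι ι)) *
        act12 (flipOp ι ι) := by
        simp only [← mul_assoc, act23_flipOp_mul_self, one_mul]
    _ = _ := by rw [h]; simp only [mul_assoc, act12_flipOp_mul_self, mul_one]

theorem act23_mul_act12_flipOp_mul_act23_flipOp (A : Matrix (ι × ι) (ι × ι) ℂ) :
    (act23 A * act12 (flipOp ι ι) * act23 (flipOp ι ι) : Matrix (ι × ι × ι) _ ℂ) =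
      act12 (flipOp ι ι) * act23 (flipOp ι ι) * act12 A := by
  have h := (act13_eq_conj_act23 A).symm.trans (act13_eq_conj_act12 A)
  calc _ = act12 (flipOp ι ι) * (act12 (flipOp ι ι) * act23 A * act12 (flipOp ι ι)) *
        act23 (flipOp ι ι) := by
        simp only [← mul_assoc, act12_flipOp_mul_self, one_mul]
    _ = _ := by rw [h]; simp only [mul_assoc, act23_flipOp_mul_self, mul_one]

theorem SatisfiesYBE.of_braid {R : ParamEnd ι ι}
    (h : ∀ z₁ z₂ z₃, (act23 (R z₁ z₂) * act12 (R z₁ z₃) * act23 (R z₂ z₃) :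
        Matrix (ι × ι × ι) _ ℂ) = act12 (R z₂ z₃) * act23 (R z₁ z₃) * act12 (R z₁ z₂)) :
    SatisfiesYBE (fun z₁ z₂ => flipOp ι ι * R z₁ z₂) (fun z₁ z₂ => flipOp ι ι * R z₁ z₂)
      fun z₁ z₂ => flipOp ι ι * R z₁ z₂ := by
  intro z₁ z₂ z₃
  set P : Matrix (ι × ι × ι) (ι × ι × ι) ℂ := act12 (flipOp ι ι) with hP
  set Q : Matrix (ι × ι × ι) (ι × ι × ι) ℂ := act23 (flipOp ι ι) with hQ
  have hleft : act12 (flipOp ι ι * R z₁ z₂) * act13 (flipOp ι ι * R z₁ z₃) *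
      act23 (flipOp ι ι * R z₂ z₃) =
        P * Q * P * (act23 (R z₁ z₂) * act12 (R z₁ z₃) * act23 (R z₂ z₃)) := by
    calc _ = P * (act12 (R z₁ z₂) * Q * P) * act12 (R z₁ z₃) * (Q * Q) * act23 (R z₂ z₃) := by
          simp only [act12_mul, act23_mul, act13_eq_conj_act12, mul_assoc, hP, hQ]
      _ = _ := by
          rw [act12_mul_act23_flipOp_mul_act12_flipOp, act23_flipOp_mul_self]
          simp only [mul_one, mul_assoc, hP, hQ]
  have hright : act23 (flipOp ι ι * R z₂ z₃) * act13 (flipOp ι ι * R z₁ z₃) *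
      act12 (flipOp ι ι * R z₁ z₂) =
        Q * P * Q * (act12 (R z₂ z₃) * act23 (R z₁ z₃) * act12 (R z₁ z₂)) := by
    calc _ = Q * (act23 (R z₂ z₃) * P * Q) * act23 (R z₁ z₃) * (P * P) * act12 (R z₁ z₂) := by
          simp only [act12_mul, act23_mul, act13_eq_conj_act23, mul_assoc, hP, hQ]
      _ = _ := by
          rw [act23_mul_act12_flipOp_mul_act23_flipOp, act12_flipOp_mul_self]
          simp only [mul_one, mul_assoc, hP, hQ]
  have hbraid : P * Q * P = Q * P * Q :=
    (act13_eq_conj_act23 (flipOp ι ι)).symm.trans (act13_eq_conj_act12 (flipOp ι ι))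
  rw [ybCommutator, hleft, hright, h, hbraid, sub_self]

theorem SatisfiesYBE.of_hecke {v : ℂ} {T : Matrix (ι × ι) (ι × ι) ℂ}
    (hecke : T * T = (1 - v) • T + v • 1)
    (braid : (act12 T * act23 T * act12 T : Matrix (ι × ι × ι) _ ℂ) =
      act23 T * act12 T * act23 T) (f : ℂˣ → ℂ) :
    SatisfiesYBE (fun z₁ z₂ => flipOp ι ι * baxterize v T (f z₁) (f z₂))
      (fun z₁ z₂ => flipOp ι ι * baxterize v T (f z₁) (f z₂))
      fun z₁ z₂ => flipOp ι ι * baxterize v T (f z₁) (f z₂) := by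
  have h12 (x y : ℂ) : (act12 (baxterize v T x y) : Matrix (ι × ι × ι) _ ℂ) =
      baxterize v (act12 T) x y := act12_smul_add_smul_one ..
  have h23 (x y : ℂ) : (act23 (baxterize v T x y) : Matrix (ι × ι × ι) _ ℂ) =
      baxterize v (act23 T) x y := act23_smul_add_smul_one ..
  refine .of_braid fun z₁ z₂ z₃ => ?_
  simp only [h12, h23]
  refine baxterize_braid ?_ ?_ braid _ _ _
  · rw [← act12_mul, hecke, act12_smul_add_smul_one]
  · rw [← act23_mul, hecke, act23_smul_add_smul_one]

end Baxterization

section PerkSchultz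

variable {ι α : Type} [DecidableEq ι] [LinearOrder α]

/-- The Hecke generator of Perk-Schultz type, for an order `r` on the basis: it acts by `ε i` on
`i ⊗ i` and is triangular on the span of `i ⊗ j` and `j ⊗ i`, with off-diagonal part `-γ`. -/
def heckeGenerator {K : Type*} [CommRing K] (v : K) (γ : ι → ι → K) (ε : ι → K) (r : ι → α) :
    Matrix (ι × ι) (ι × ι) K :=
  Matrix.of fun p q =>
    (if q = p then if p.1 = p.2 then ε p.1 else if r p.1 < r p.2 then 1 - v else 0 else 0) +
      if q = p.swap then if p.1 = p.2 then 0 else -γ p.2 p.1 else 0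

/-- The Perk-Schultz R-matrix: a Baxterized Hecke generator followed by the flip, so that it
satisfies the Yang-Baxter equation rather than the braid relation. -/
noncomputable def perkSchultz [Fintype ι] (v : ℂ) (γ : ι → ι → ℂ) (ε : ι → ℂ) (r : ι → α)
    (x y : ℂ) : Matrix (ι × ι) (ι × ι) ℂ :=
  flipOp ι ι * baxterize v (heckeGenerator v γ ε r) x y

variable [Fintype ι]

theorem heckeGenerator_mulVec {K : Type*} [CommRing K] (v : K) (γ : ι → ι → K) (ε : ι → K)
    (r : ι → α) (f : ι × ι → K) (i j : ι) :
    (heckeGenerator v γ ε r *ᵥ f) (i, j) =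
      (if i = j then ε i else if r i < r j then 1 - v else 0) * f (i, j) +
        (if i = j then 0 else -γ j i) * f (j, i) := by
  simp [Matrix.mulVec, dotProduct, heckeGenerator, add_mul, Finset.sum_add_distrib]

theorem act12_heckeGenerator_mulVec (v : ℂ) (γ : ι → ι → ℂ) (ε : ι → ℂ)
    (r : ι → α) (f : ι × ι × ι → ℂ) (i j k : ι) :
    (act12 (heckeGenerator v γ ε r) *ᵥ f) (i, j, k) =
      (if i = j then ε i else if r i < r j then 1 - v else 0) * f (i, j, k) +
        (if i = j then 0 else -γ j i) * f (j, i, k) := by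
  simp [Matrix.mulVec, dotProduct, act12, heckeGenerator, add_mul, Finset.sum_add_distrib,
    Fintype.sum_prod_type, ite_and]

theorem act23_heckeGenerator_mulVec (v : ℂ) (γ : ι → ι → ℂ) (ε : ι → ℂ)
    (r : ι → α) (f : ι × ι × ι → ℂ) (i j k : ι) :
    (act23 (heckeGenerator v γ ε r) *ᵥ f) (i, j, k) =
      (if j = k then ε j else if r j < r k then 1 - v else 0) * f (i, j, k) +
        (if j = k then 0 else -γ k j) * f (i, k, j) := by
  simp [Matrix.mulVec, dotProduct, act23, heckeGenerator, add_mul, Finset.sum_add_distrib,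
    Fintype.sum_prod_type]

theorem heckeGenerator_mul_self {K : Type*} [CommRing K] {v : K} {γ : ι → ι → K} {ε : ι → K}
    {r : ι → α} (hr : Function.Injective r) (hγ : ∀ i j, i ≠ j → γ i j * γ j i = v)
    (hε : ∀ i, (ε i - 1) * (ε i + v) = 0) :
    heckeGenerator v γ ε r * heckeGenerator v γ ε r =
      (1 - v) • heckeGenerator v γ ε r + v • 1 := by
  rw [Matrix.ext_iff_mulVec]
  intro f
  ext ⟨i, j⟩
  simp only [← Matrix.mulVec_mulVec, Matrix.add_mulVec, Matrix.smul_mulVec, Matrix.one_mulVec,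
    Pi.add_apply, Pi.smul_apply, smul_eq_mul, heckeGenerator_mulVec]
  rcases eq_or_ne i j with rfl | hij
  · have := hε i
    grind
  · have := hγ i j hij
    rcases lt_or_gt_of_ne (hr.ne hij) with h | h <;>
    · simp only [hij, hij.symm, h, h.not_gt, if_true, if_false]
      grind

theorem heckeGenerator_braid {v : ℂ} {γ : ι → ι → ℂ} {ε : ι → ℂ}
    {r : ι → α} (hr : Function.Injective r) (hγ : ∀ i j, i ≠ j → γ i j * γ j i = v)
    (hε : ∀ i, (ε i - 1) * (ε i + v) = 0) :
    (act12 (heckeGenerator v γ ε r) * act23 (heckeGenerator v γ ε r) *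
        act12 (heckeGenerator v γ ε r) : Matrix (ι × ι × ι) _ ℂ) =
      act23 (heckeGenerator v γ ε r) * act12 (heckeGenerator v γ ε r) *
        act23 (heckeGenerator v γ ε r) := by
  rw [Matrix.ext_iff_mulVec]
  intro f
  ext ⟨i, j, k⟩
  simp only [← Matrix.mulVec_mulVec, act12_heckeGenerator_mulVec, act23_heckeGenerator_mulVec]
  by_cases hij : i = j <;> by_cases hjk : j = k
  · subst hij hjk
    simp only [if_true, zero_mul, add_zero]
  · subst hij
    rcases lt_or_gt_of_ne (hr.ne hjk) with h | h <;>
    · simp only [hjk, Ne.symm hjk, h, h.not_gt, if_true, if_false]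
      grind
  · subst hjk
    rcases lt_or_gt_of_ne (hr.ne hij) with h | h <;>
    · simp only [hij, Ne.symm hij, h, h.not_gt, if_true, if_false]
      grind
  · by_cases hik : i = k
    · subst hik
      rcases lt_or_gt_of_ne (hr.ne hij) with h | h <;>
      · simp only [hij, hjk, h, h.not_gt, if_true, if_false]
        grind
    · rcases lt_or_gt_of_ne (hr.ne hij) with h | h <;>
      rcases lt_or_gt_of_ne (hr.ne hjk) with h' | h' <;>
      rcases lt_or_gt_of_ne (hr.ne hik) with h'' | h'' <;>
      · simp only [hij, hjk, hik, Ne.symm hij, Ne.symm hjk, h, h.not_gt, h', h'.not_gt, h'',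
          h''.not_gt, if_true, if_false]
        grind

theorem satisfiesYBE_perkSchultz {v : ℂ} {γ : ι → ι → ℂ} {ε : ι → ℂ} {r : ι → α}
    (hr : Function.Injective r) (hγ : ∀ i j, i ≠ j → γ i j * γ j i = v)
    (hε : ∀ i, (ε i - 1) * (ε i + v) = 0) (f : ℂˣ → ℂ) :
    SatisfiesYBE (fun z₁ z₂ => perkSchultz v γ ε r (f z₁) (f z₂))
      (fun z₁ z₂ => perkSchultz v γ ε r (f z₁) (f z₂))
      fun z₁ z₂ => perkSchultz v γ ε r (f z₁) (f z₂) :=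
  .of_hecke (heckeGenerator_mul_self hr hγ hε) (heckeGenerator_braid hr hγ hε) f

theorem perkSchultz_apply (v : ℂ) (γ : ι → ι → ℂ) (ε : ι → ℂ) (r : ι → α) (x y : ℂ)
    (p q : ι × ι) :
    perkSchultz v γ ε r x y p q =
      if p.1 = p.2 then if q = p then (y - x) * ε p.1 + (1 - v) * x else 0
      else if q = p then γ p.1 p.2 * (x - y)
      else if q = p.swap then (1 - v) * (if r p.2 < r p.1 then y else x) else 0 := by
  obtain ⟨i, j⟩ := p
  obtain ⟨k, l⟩ := q
  rw [perkSchultz, flipOp_mul_apply]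
  simp only [baxterize, heckeGenerator, Matrix.add_apply, Matrix.smul_apply, Matrix.of_apply,
    Matrix.one_apply, smul_eq_mul, Prod.swap, Prod.mk.injEq]
  grind

end PerkSchultz

/-! ### Representatives modulo `n` -/

section PosRep

variable {n : ℕ} [NeZero n]

theorem posRep_pos (a : ZMod n) : 0 < posRep a := by
  unfold posRep
  split_ifs with h
  · exact NeZero.pos n
  · exact Nat.pos_of_ne_zero ((ZMod.val_ne_zero a).2 h)

theorem posRep_le (a : ZMod n) : posRep a ≤ n := by
  unfold posRep
  split_ifs with h
  · exact le_rfl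
  · exact a.val_lt.le

theorem natCast_posRep (a : ZMod n) : (posRep a : ZMod n) = a := by
  unfold posRep
  split_ifs with h
  · rw [ZMod.natCast_self, h]
  · exact ZMod.natCast_zmod_val a

theorem posRep_injective : Function.Injective (posRep : ZMod n → ℕ) :=
  Function.LeftInverse.injective natCast_posRep

theorem posRep_natCast {m : ℕ} (hm : 0 < m) (hmn : m ≤ n) : posRep (m : ZMod n) = m := by
  rcases hmn.lt_or_eq with h | rfl
  · have hval : (m : ZMod n).val = m := ZMod.val_natCast_of_lt h
    rw [posRep, if_neg (by rw [← ZMod.val_eq_zero, hval]; exact hm.ne'), hval]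
  · rw [ZMod.natCast_self, posRep, if_pos rfl]

theorem posRep_one_sub (a : ZMod n) : posRep (1 - a) = n + 1 - posRep a := by
  have hpos := posRep_pos a
  have hle := posRep_le a
  have hcast : (1 - a : ZMod n) = ((n + 1 - posRep a : ℕ) : ZMod n) := by
    rw [Nat.cast_sub (by lia)]
    simp [natCast_posRep]
  rw [hcast, posRep_natCast (by lia) (by lia)]

theorem posRep_one_sub_sub_one (a : ZMod n) : posRep (1 - a) - 1 = n - posRep a := by
  rw [posRep_one_sub, Nat.sub_right_comm, Nat.add_sub_cancel]

theorem val_sub_eq_posRep_sub (a b : ZMod n) :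
    (a - b).val = (if posRep a < posRep b then n else 0) + posRep a - posRep b := by
  have hpos_a := posRep_pos a
  have hpos_b := posRep_pos b
  have hle_a := posRep_le a
  have hle_b := posRep_le b
  have hcast : (a - b : ZMod n) =
      (((if posRep a < posRep b then n else 0) + posRep a - posRep b : ℕ) : ZMod n) := by
    rw [Nat.cast_sub (by split_ifs <;> lia)]
    split_ifs <;> simp [natCast_posRep]
  rw [hcast, ZMod.val_natCast_of_lt (by split_ifs <;> lia)]

theorem pow_val_sub_mul_pow_sub_val_sub {K : Type*} [Field K] {x y : K} (hx : x ≠ 0) (hy : y ≠ 0)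
    {a b : ZMod n} (hab : a ≠ b) :
    x ^ (a - b).val * y ^ (n - (a - b).val) =
      x ^ posRep a * y ^ posRep b * (x ^ posRep b * y ^ posRep a)⁻¹ *
        if posRep b < posRep a then y ^ n else x ^ n := by
  have hle := (posRep_le b).trans (Nat.le_add_right n (posRep a))
  rw [pow_sub₀ y hy (a - b).val_lt.le, val_sub_eq_posRep_sub]
  rcases lt_or_gt_of_ne (posRep_injective.ne hab) with h | h
  · rw [if_pos h, if_neg h.not_gt, pow_sub₀ x hx hle, pow_sub₀ y hy hle, pow_add, pow_add]
    field_simp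
  · rw [if_neg h.not_gt, if_pos h, zero_add, pow_sub₀ x hx h.le, pow_sub₀ y hy h.le]
    field_simp

theorem pow_val_sub_mul_pow_posRep {K : Type*} [CommMonoid K] (x : K) (a b : ZMod n) :
    x ^ (a - b).val * x ^ posRep b =
      (if posRep a < posRep b then x ^ n else 1) * x ^ posRep a := by
  have := posRep_le b
  rw [val_sub_eq_posRep_sub, ← pow_add]
  split_ifs
  · rw [← pow_add]
    congr 1
    lia
  · rw [one_mul]
    congr 1
    lia

end PosRep

/-! ### The equations for one kind of ice -/

theorem ParamEnd.eq_gauge_perkSchultz {ι α : Type} [Fintype ι] [DecidableEq ι] [LinearOrder α]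
    {A : ParamEnd ι ι} {d : ℂˣ → ι → ℂˣ} {v : ℂ} {γ : ι → ι → ℂ} {ε : ι → ℂ} {r : ι → α}
    {f : ℂˣ → ℂ}
    (hself : ∀ z₁ z₂ i, A z₁ z₂ (i, i) (i, i) = (f z₂ - f z₁) * ε i + (1 - v) * f z₁)
    (hdiag : ∀ z₁ z₂ i j, i ≠ j → A z₁ z₂ (i, j) (i, j) = γ i j * (f z₁ - f z₂))
    (hswap : ∀ z₁ z₂ i j, i ≠ j → A z₁ z₂ (i, j) (j, i) =
      (d z₁ i * d z₂ j : ℂ) * ↑(d z₁ j * d z₂ i)⁻¹ *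
        ((1 - v) * if r j < r i then f z₂ else f z₁))
    (hzero : ∀ z₁ z₂ p q, q ≠ p → q ≠ p.swap → A z₁ z₂ p q = 0) :
    A = ParamEnd.gauge d d fun z₁ z₂ => perkSchultz v γ ε r (f z₁) (f z₂) := by
  funext z₁ z₂
  ext ⟨i, j⟩ q
  have hcancel : (d z₁ i * d z₂ j : ℂ) * ↑(d z₁ i * d z₂ j)⁻¹ = 1 := by
    rw [← Units.val_mul]
    exact Units.mul_inv _
  rw [ParamEnd.gauge, Matrix.of_apply, perkSchultz_apply]
  by_cases hq : q = (i, j)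
  · subst hq
    rw [hcancel, one_mul, if_pos rfl, if_pos rfl]
    split_ifs with hij
    · obtain rfl : i = j := hij
      exact hself z₁ z₂ _
    · exact hdiag z₁ z₂ i j hij
  by_cases hq' : q = (j, i)
  · subst hq'
    have hij : i ≠ j := fun h => hq (by rw [h])
    rw [if_neg hij, if_neg hq, Prod.swap, if_pos rfl]
    exact hswap z₁ z₂ i j hij
  · rw [hzero z₁ z₂ _ _ hq hq']
    simp [hq, hq']

section GammaGamma

variable {n : ℕ}

namespace GammaEdge

/-- The position of an edge of Gamma ice in the order `-, +₁, …, +ₙ`. -/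
def rank : GammaEdge n → ℕ
  | .plus a => posRep a
  | .minus => 0

/-- The twist `γ` of the Perk-Schultz R-matrix underlying `R^{ΓΓ}`. -/
def perkSchultzTwist (v : ℂ) (g : ZMod n → ℂ) : GammaEdge n → GammaEdge n → ℂ
  | .plus b, .plus a => g (a - b)
  | .plus _, .minus => v
  | .minus, _ => 1

/-- The eigenvalues `ε` of the Perk-Schultz R-matrix underlying `R^{ΓΓ}`. -/
def heckeEigenvalue (v : ℂ) : GammaEdge n → ℂ
  | .plus _ => 1
  | .minus => -v

theorem rank_injective [NeZero n] : Function.Injective (rank : GammaEdge n → ℕ) := by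
  rintro (a | _) (b | _) h
  · rw [posRep_injective h]
  · exact absurd h (posRep_pos a).ne'
  · exact absurd h (posRep_pos b).ne
  · rfl

theorem perkSchultzTwist_mul_swap {v : ℂ} {g : ZMod n → ℂ}
    (hg : ∀ a : ZMod n, a ≠ 0 → g (-a) * g a = v) (i j : GammaEdge n) (hij : i ≠ j) :
    perkSchultzTwist v g i j * perkSchultzTwist v g j i = v := by
  rcases i with b | _ <;> rcases j with a | _ <;> simp only [perkSchultzTwist, mul_one, one_mul]
  · rw [← neg_sub b a, hg _ (sub_ne_zero.2 fun h => hij (congrArg _ h))]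
  · exact absurd rfl hij

theorem heckeEigenvalue_sub_one_mul_add (v : ℂ) (i : GammaEdge n) :
    (heckeEigenvalue v i - 1) * (heckeEigenvalue v i + v) = 0 := by
  cases i <;> simp [heckeEigenvalue]

end GammaEdge

theorem RGammaGamma_apply_swap [NeZero n] (v : ℂ) (g : ZMod n → ℂ) (z₁ z₂ : ℂˣ)
    (i j : GammaEdge n) (hij : i ≠ j) :
    RGammaGamma v g z₁ z₂ (i, j) (j, i) =
      (↑(z₁ ^ i.rank) * ↑(z₂ ^ j.rank) : ℂ) * ↑(z₁ ^ j.rank * z₂ ^ i.rank)⁻¹ *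
        ((1 - v) * if j.rank < i.rank then (z₂ : ℂ) ^ n else (z₁ : ℂ) ^ n) := by
  have h₁ := z₁.ne_zero
  have h₂ := z₂.ne_zero
  rcases i with a | _ <;> rcases j with b | _
  · have hab : a ≠ b := fun h => hij (congrArg _ h)
    have hweight : RGammaGamma v g z₁ z₂ (.plus a, .plus b) (.plus b, .plus a) =
        (1 - v) * ((z₁ : ℂ) ^ (a - b).val * (z₂ : ℂ) ^ (n - (a - b).val)) := by
      simp [RGammaGamma, weightGammaGamma, hab, hab.symm, mul_assoc]
    rw [hweight, pow_val_sub_mul_pow_sub_val_sub h₁ h₂ hab, mul_left_comm]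
    push_cast
    rfl
  · simp only [RGammaGamma, weightGammaGamma, Matrix.of_apply, GammaEdge.rank, posRep_pos, if_true,
      pow_sub₀ _ h₂ (posRep_le a), Units.val_pow_eq_pow_val, Units.val_inv_eq_inv_val, pow_zero,
      Units.val_one, mul_one, one_mul]
    ring
  · simp only [RGammaGamma, weightGammaGamma, Matrix.of_apply, GammaEdge.rank, not_lt_zero,
      if_true, if_false, pow_sub₀ _ h₁ (posRep_le b), Units.val_pow_eq_pow_val,
      Units.val_inv_eq_inv_val, pow_zero, Units.val_one, mul_one, one_mul]
    ring
  · exact absurd rfl hij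

theorem RGammaGamma_apply_eq_zero (v : ℂ) (g : ZMod n → ℂ) (z₁ z₂ : ℂˣ)
    (p q : GammaEdge n × GammaEdge n) (hqp : q ≠ p) (hqp' : q ≠ p.swap) :
    RGammaGamma v g z₁ z₂ p q = 0 := by
  obtain ⟨_ | _, _ | _⟩ := p <;> obtain ⟨_ | _, _ | _⟩ := q <;>
    simp only [RGammaGamma, Matrix.of_apply, weightGammaGamma] <;> grind

theorem RGammaGamma_eq_gauge_perkSchultz [NeZero n] (v : ℂ) (g : ZMod n → ℂ) :
    RGammaGamma v g = ParamEnd.gauge (fun z i => z ^ i.rank) (fun z i => z ^ i.rank)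
      fun z₁ z₂ => perkSchultz v (GammaEdge.perkSchultzTwist v g) (GammaEdge.heckeEigenvalue v)
        GammaEdge.rank ((z₁ : ℂ) ^ n) ((z₂ : ℂ) ^ n) := by
  refine ParamEnd.eq_gauge_perkSchultz (f := fun z => (z : ℂ) ^ n) (fun z₁ z₂ i => ?_)
    (fun z₁ z₂ i j hij => ?_) (RGammaGamma_apply_swap v g) (RGammaGamma_apply_eq_zero v g)
  · cases i <;>
      simp only [RGammaGamma, weightGammaGamma, Matrix.of_apply, GammaEdge.heckeEigenvalue,
        and_self, if_true] <;>
      ring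
  · rcases i with a | _ <;> rcases j with b | _ <;>
      simp only [RGammaGamma, weightGammaGamma, Matrix.of_apply, GammaEdge.perkSchultzTwist] <;>
      grind

theorem RGammaGamma_satisfiesYBE [NeZero n] {v : ℂ} {g : ZMod n → ℂ}
    (hg : ∀ a : ZMod n, a ≠ 0 → g (-a) * g a = v) :
    SatisfiesYBE (RGammaGamma v g) (RGammaGamma v g) (RGammaGamma v g) := by
  rw [RGammaGamma_eq_gauge_perkSchultz]
  exact (satisfiesYBE_perkSchultz GammaEdge.rank_injective
    (GammaEdge.perkSchultzTwist_mul_swap hg) (GammaEdge.heckeEigenvalue_sub_one_mul_add v)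
    fun z => (z : ℂ) ^ n).gauge _ _ _

end GammaGamma

section DeltaDelta

variable {n : ℕ}

namespace DeltaEdge

/-- The position of an edge of Delta ice in the order `+, -₁, …, -ₙ`. -/
def rank : DeltaEdge n → ℕ
  | .minus a => posRep a
  | .plus => 0

/-- The twist `γ` of the Perk-Schultz R-matrix underlying `(R^{ΔΔ})^‡`. -/
def perkSchultzTwist (v : ℂ) (g : ZMod n → ℂ) : DeltaEdge n → DeltaEdge n → ℂ
  | .minus a, .minus b => -g (b - a)
  | .minus _, .plus => -v
  | .plus, _ => -1

/-- The eigenvalues `ε` of the Perk-Schultz R-matrix underlying `(R^{ΔΔ})^‡`. -/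
def heckeEigenvalue (v : ℂ) : DeltaEdge n → ℂ
  | .minus _ => -v
  | .plus => 1

theorem rank_injective [NeZero n] : Function.Injective (rank : DeltaEdge n → ℕ) := by
  rintro (a | _) (b | _) h
  · rw [posRep_injective h]
  · exact absurd h (posRep_pos a).ne'
  · exact absurd h (posRep_pos b).ne
  · rfl

theorem perkSchultzTwist_mul_swap {v : ℂ} {g : ZMod n → ℂ}
    (hg : ∀ a : ZMod n, a ≠ 0 → g (-a) * g a = v) (i j : DeltaEdge n) (hij : i ≠ j) :
    perkSchultzTwist v g i j * perkSchultzTwist v g j i = v := by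
  rcases i with a | _ <;> rcases j with b | _ <;>
    simp only [perkSchultzTwist, neg_mul_neg, mul_one, one_mul]
  · rw [← neg_sub a b, hg _ (sub_ne_zero.2 fun h => hij (congrArg _ h))]
  · exact absurd rfl hij

theorem heckeEigenvalue_sub_one_mul_add (v : ℂ) (i : DeltaEdge n) :
    (heckeEigenvalue v i - 1) * (heckeEigenvalue v i + v) = 0 := by
  cases i <;> simp [heckeEigenvalue]

end DeltaEdge

theorem RDeltaDelta_apply_swap [NeZero n] (v : ℂ) (g : ZMod n → ℂ) (z₁ z₂ : ℂˣ)
    (i j : DeltaEdge n) (hij : i ≠ j) :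
    RDeltaDelta v g z₂ z₁ (j, i) (i, j) =
      (↑(z₁ ^ (i.rank - 1)) * ↑(z₂ ^ (j.rank - 1)) : ℂ) *
        ↑(z₁ ^ (j.rank - 1) * z₂ ^ (i.rank - 1))⁻¹ *
        ((1 - v) * if j.rank < i.rank then (z₂ : ℂ) ^ n else (z₁ : ℂ) ^ n) := by
  have h₁ := z₁.ne_zero
  have h₂ := z₂.ne_zero
  rcases i with a | _ <;> rcases j with b | _
  · have hab : a ≠ b := fun h => hij (congrArg _ h)
    have hweight : RDeltaDelta v g z₂ z₁ (.minus b, .minus a) (.minus a, .minus b) =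
        (1 - v) * ((z₁ : ℂ) ^ (a - b).val * (z₂ : ℂ) ^ (n - (a - b).val)) := by
      simp [RDeltaDelta, weightDeltaDelta, hab, mul_assoc, mul_comm,
        mul_left_comm]
    rw [hweight, pow_val_sub_mul_pow_sub_val_sub h₁ h₂ hab, mul_left_comm]
    push_cast
    simp only [DeltaEdge.rank, pow_sub₀ _ h₁ (posRep_pos _), pow_sub₀ _ h₂ (posRep_pos _)]
    field_simp
    rfl
  · simp only [RDeltaDelta, weightDeltaDelta, Matrix.of_apply, DeltaEdge.rank, posRep_pos, if_true,
      pow_sub₀ _ h₁ (posRep_pos a), pow_sub₀ _ h₂ (posRep_pos a), pow_sub₀ _ h₂ (posRep_le a),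
      Nat.succ_eq_add_one, zero_add, zero_tsub, pow_add, pow_one, pow_zero,
      Units.val_pow_eq_pow_val, Units.val_inv_eq_inv_val, Units.val_one, mul_one, one_mul,
      mul_inv_rev, inv_inv]
    field_simp
  · simp only [RDeltaDelta, weightDeltaDelta, Matrix.of_apply, DeltaEdge.rank, not_lt_zero,
      if_true, if_false, pow_sub₀ _ h₂ (posRep_pos b), pow_sub₀ _ h₁ (posRep_pos b),
      pow_sub₀ _ h₁ (posRep_le b), Nat.succ_eq_add_one, zero_add, zero_tsub, pow_add, pow_one,
      pow_zero, Units.val_pow_eq_pow_val, Units.val_inv_eq_inv_val, Units.val_one, mul_one,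
      one_mul, mul_inv_rev, inv_inv]
    field_simp
  · exact absurd rfl hij

theorem RDeltaDelta_apply_eq_zero (v : ℂ) (g : ZMod n → ℂ) (z₁ z₂ : ℂˣ)
    (p q : DeltaEdge n × DeltaEdge n) (hqp : q ≠ p) (hqp' : q ≠ p.swap) :
    RDeltaDelta v g z₁ z₂ p q = 0 := by
  obtain ⟨_ | _, _ | _⟩ := p <;> obtain ⟨_ | _, _ | _⟩ := q <;>
    simp only [RDeltaDelta, Matrix.of_apply, weightDeltaDelta] <;> grind

variable [NeZero n]

theorem ddagger_RDeltaDelta_apply_eq_zero (v : ℂ) (g : ZMod n → ℂ) (z₁ z₂ : ℂˣ)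
    (p q : DeltaEdge n × DeltaEdge n) (hqp : q ≠ p) (hqp' : q ≠ p.swap) :
    ddagger (RDeltaDelta v g) z₁ z₂ p q = 0 := by
  rw [ddagger_apply]
  exact RDeltaDelta_apply_eq_zero v g z₂ z₁ _ _ (Prod.swap_injective.ne hqp)
    (Prod.swap_injective.ne hqp')

-- On `+` the truncated subtraction `rank - 1` gives `0`.
theorem ddagger_RDeltaDelta_eq_gauge_perkSchultz (v : ℂ) (g : ZMod n → ℂ) :
    ddagger (RDeltaDelta v g) =
      ParamEnd.gauge (fun z i => z ^ (i.rank - 1)) (fun z i => z ^ (i.rank - 1))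
        fun z₁ z₂ => perkSchultz v (DeltaEdge.perkSchultzTwist v g) (DeltaEdge.heckeEigenvalue v)
          DeltaEdge.rank ((z₁ : ℂ) ^ n) ((z₂ : ℂ) ^ n) := by
  refine ParamEnd.eq_gauge_perkSchultz (f := fun z => (z : ℂ) ^ n) (fun z₁ z₂ i => ?_)
    (fun z₁ z₂ i j hij => ?_) (fun z₁ z₂ i j hij => ?_) (ddagger_RDeltaDelta_apply_eq_zero v g) <;>
    rw [ddagger_apply]
  · cases i <;>
      simp only [RDeltaDelta, weightDeltaDelta, Matrix.of_apply, Prod.swap_prod_mk,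
        DeltaEdge.heckeEigenvalue, and_self, if_true] <;>
      ring
  · rcases i with a | _ <;> rcases j with b | _ <;>
      simp only [RDeltaDelta, weightDeltaDelta, Matrix.of_apply, Prod.swap_prod_mk,
        DeltaEdge.perkSchultzTwist] <;>
      grind
  · exact RDeltaDelta_apply_swap v g z₁ z₂ i j hij

theorem ddagger_RDeltaDelta_satisfiesYBE {v : ℂ} {g : ZMod n → ℂ}
    (hg : ∀ a : ZMod n, a ≠ 0 → g (-a) * g a = v) :
    SatisfiesYBE (ddagger (RDeltaDelta v g)) (ddagger (RDeltaDelta v g))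
      (ddagger (RDeltaDelta v g)) := by
  rw [ddagger_RDeltaDelta_eq_gauge_perkSchultz]
  exact (satisfiesYBE_perkSchultz DeltaEdge.rank_injective
    (DeltaEdge.perkSchultzTwist_mul_swap hg) (DeltaEdge.heckeEigenvalue_sub_one_mul_add v)
    fun z => (z : ℂ) ^ n).gauge _ _ _

end DeltaDelta

/-! ### Crossing -/

/-- The only nonzero entries of `A` off the diagonal belong to the block of rows and columns in the
image of `f`. -/
def DiagonalOutside {ι κ K : Type*} [Zero K] (f : κ → ι) (A : Matrix ι ι K) : Prop :=
  ∀ p q, p ≠ q → A p q ≠ 0 → p ∈ Set.range f ∧ q ∈ Set.range f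

theorem DiagonalOutside.ext {ι κ K : Type*} [Zero K] {f : κ → ι} {A B : Matrix ι ι K}
    (hA : DiagonalOutside f A) (hB : DiagonalOutside f B)
    (hblock : ∀ k i, A (f k) (f i) = B (f k) (f i))
    (hdiag : ∀ p ∉ Set.range f, A p p = B p p) : A = B := by
  ext p q
  by_cases hpq : p ∈ Set.range f ∧ q ∈ Set.range f
  · obtain ⟨⟨k, rfl⟩, i, rfl⟩ := hpq
    exact hblock k i
  rcases eq_or_ne p q with rfl | hne
  · exact hdiag p fun hp => hpq ⟨hp, hp⟩
  · rw [not_not.1 (mt (hA p q hne) hpq), not_not.1 (mt (hB p q hne) hpq)]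

theorem DiagonalOutside.mul_eq_smul_one {ι κ R : Type*} [Fintype ι] [Fintype κ] [DecidableEq ι]
    [DecidableEq κ] [CommSemiring R] {f : κ → ι} {A B : Matrix ι ι R} {c : R}
    (hA : DiagonalOutside f A) (hB : DiagonalOutside f B) (hf : Function.Injective f)
    (hblock : ∀ k i, ∑ m, A (f k) (f m) * B (f m) (f i) = if k = i then c else 0)
    (hdiag : ∀ p ∉ Set.range f, A p p * B p p = c) : A * B = c • 1 := by
  have hzeroA {p q} (hne : p ≠ q) (h : ¬(p ∈ Set.range f ∧ q ∈ Set.range f)) : A p q = 0 :=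
    not_not.1 (mt (hA p q hne) h)
  have hzeroB {p q} (hne : p ≠ q) (h : ¬(p ∈ Set.range f ∧ q ∈ Set.range f)) : B p q = 0 :=
    not_not.1 (mt (hB p q hne) h)
  ext p q
  rw [Matrix.mul_apply, Matrix.smul_apply, Matrix.one_apply, smul_eq_mul, mul_ite, mul_one,
    mul_zero]
  by_cases hp : p ∈ Set.range f
  · obtain ⟨k, rfl⟩ := hp
    by_cases hq : q ∈ Set.range f
    · obtain ⟨i, rfl⟩ := hq
      rw [← Fintype.sum_of_injective f hf _ _ (fun s hs => ?_) fun _ => rfl, hblock]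
      · simp only [hf.eq_iff]
      · rw [hzeroA (fun h => hs ⟨k, h⟩) fun h => hs h.2, zero_mul]
    · have hkq : f k ≠ q := fun h => hq ⟨k, h⟩
      rw [if_neg hkq, Fintype.sum_eq_single q fun s hs => ?_, hzeroA hkq fun h => hq h.2, zero_mul]
      rw [hzeroB hs fun h => hq h.2, mul_zero]
  · rw [Fintype.sum_eq_single p fun s hs => by rw [hzeroA hs.symm fun h => hp h.1, zero_mul]]
    split_ifs with hpq
    · rw [← hpq, hdiag p hp]
    · rw [hzeroB hpq fun h => hp h.1, mul_zero]

theorem ddagger_diagonalOutside {ι κ : Type} [Fintype ι] [Fintype κ] [DecidableEq ι]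
    [DecidableEq κ] {A : ParamEnd ι κ} (e : κ ≃ ι)
    (hA : ∀ z₁ z₂, DiagonalOutside (fun k => (k, e.symm k)) (A z₁ z₂)) (z₁ z₂ : ℂˣ) :
    DiagonalOutside (fun k => (k, e k)) (ddagger A z₁ z₂) := by
  intro p q hne hentry
  rw [ddagger_apply] at hentry
  obtain ⟨⟨k, hk⟩, i, hi⟩ := hA z₂ z₁ _ _ (Prod.swap_injective.ne hne) hentry
  refine ⟨⟨e.symm k, ?_⟩, e.symm i, ?_⟩
  · rw [← p.swap_swap, ← hk]
    simp only [e.apply_symm_apply, Prod.swap_prod_mk]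
  · rw [← q.swap_swap, ← hi]
    simp only [e.apply_symm_apply, Prod.swap_prod_mk]

theorem ParamEnd.diagonalOutside_twist_crossing {ι μ : Type} {A : ParamEnd ι ι}
    (hzero : ∀ z₁ z₂ p q, q ≠ p → q ≠ p.swap → A z₁ z₂ p q = 0) (u : ℂˣ) (ψ : μ ≃ ι)
    (x y : ι → ℂ) (z₁ z₂ : ℂˣ) :
    DiagonalOutside (fun k => (k, ψ.symm k)) ((A.crossing u ψ).twist x y z₁ z₂) := by
  rintro ⟨k, l⟩ ⟨i, j⟩ hne hentry
  have hA : A (u * z₂) z₁ (ψ j, k) (ψ l, i) ≠ 0 := right_ne_zero_of_mul hentry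
  by_cases hq : (ψ l, i) = (ψ j, k)
  · simp only [Prod.mk.injEq, EmbeddingLike.apply_eq_iff_eq] at hq
    exact absurd (by rw [hq.1, hq.2]) hne
  by_cases hq' : (ψ l, i) = (k, ψ j)
  · simp only [Prod.mk.injEq] at hq'
    simp [← hq'.1, hq'.2]
  · exact absurd (hzero _ _ _ _ hq hq') hA

theorem SatisfiesYBE.twist_crossing {ι μ : Type} [Fintype ι] [Fintype μ] [DecidableEq ι]
    [DecidableEq μ] {A : ParamEnd ι ι} (h : SatisfiesYBE A A A)
    (hzero : ∀ z₁ z₂ p q, q ≠ p → q ≠ p.swap → A z₁ z₂ p q = 0) (u : ℂˣ) (ψ : μ ≃ ι)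
    (x y : ι → ℂ) :
    SatisfiesYBE A ((A.crossing u ψ).twist x y) ((A.crossing u ψ).twist x y) := by
  have hmul (x : ι → ℂ) (z₁ z₂ p q) (hA : A z₁ z₂ p q ≠ 0) : x p.1 * x p.2 = x q.1 * x q.2 := by
    rcases eq_or_ne q p with rfl | hqp
    · rfl
    · have hq : q = p.swap := by_contra fun hq => hA (hzero z₁ z₂ p q hqp hq)
      rw [hq, Prod.fst_swap, Prod.snd_swap, mul_comm]
  exact (h.crossing u ψ).twist (hmul x) (hmul y)

section GammaDelta

variable {n : ℕ}

/-- The duality `-_b ↔ +_{1 - b}`, `+ ↔ -` between the edges of Delta and Gamma ice. -/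
def DeltaEdge.dual : DeltaEdge n ≃ GammaEdge n where
  toFun
    | .minus b => .plus (1 - b)
    | .plus => .minus
  invFun
    | .plus a => .minus (1 - a)
    | .minus => .plus
  left_inv e := by cases e <;> simp
  right_inv e := by cases e <;> simp

/-- The left twist that turns the crossing of `R^{ΓΓ}` into `R^{ΓΔ}`. -/
def GammaEdge.rowTwist (u : ℂˣ) : GammaEdge n → ℂ
  | .plus a => -(u : ℂ) ^ posRep a
  | .minus => 1

/-- The right twist that turns the crossing of `R^{ΓΓ}` into `R^{ΓΔ}`. -/
noncomputable def GammaEdge.colTwist (v : ℂ) (u : ℂˣ) : GammaEdge n → ℂ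
  | .plus a => ((u : ℂ) ^ posRep a)⁻¹
  | .minus => -v⁻¹

/-- The left twist that turns the crossing of `(R^{ΔΔ})^‡` into `(R^{ΓΔ})^‡`. -/
noncomputable def DeltaEdge.rowTwist (v : ℂ) (u : ℂˣ) : DeltaEdge n → ℂ
  | .minus a => -v * u * ((u : ℂ) ^ posRep a)⁻¹
  | .plus => 1

/-- The right twist that turns the crossing of `(R^{ΔΔ})^‡` into `(R^{ΓΔ})^‡`. -/
noncomputable def DeltaEdge.colTwist (u : ℂˣ) : DeltaEdge n → ℂ
  | .minus a => (u : ℂ) ^ posRep a * (u : ℂ)⁻¹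
  | .plus => -1

theorem RGammaDelta_diagonalOutside (v : ℂ) (g : ZMod n → ℂ) (z₁ z₂ : ℂˣ) :
    DiagonalOutside (fun k => (k, DeltaEdge.dual.symm k)) (RGammaDelta v g z₁ z₂) := by
  rintro ⟨c | _, d | _⟩ ⟨a | _, b | _⟩ hne hentry <;>
    simp only [RGammaDelta, weightGammaDelta, Matrix.of_apply, DeltaEdge.dual, Equiv.symm_mk,
      Equiv.coe_fn_mk, Set.mem_range, Prod.mk.injEq] at hne hentry ⊢ <;>
    grind

theorem RGammaDelta_eq_twist_crossing [NeZero n] {v : ℂ} (hv : v ≠ 0) (g : ZMod n → ℂ) {u : ℂˣ}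
    (hu : (u : ℂ) ^ n = v) :
    RGammaDelta v g = (ParamEnd.crossing u DeltaEdge.dual (RGammaGamma v g)).twist
      (GammaEdge.rowTwist u) (GammaEdge.colTwist v u) := by
  funext z₁ z₂
  have hu0 := u.ne_zero
  refine (RGammaDelta_diagonalOutside v g z₁ z₂).ext
    (ParamEnd.diagonalOutside_twist_crossing (RGammaGamma_apply_eq_zero v g) _ _ _ _ _ _) ?_ ?_
  · rintro (c | _) (a | _) <;>
      simp only [RGammaDelta, RGammaGamma, weightGammaDelta, weightGammaGamma, ParamEnd.twist,
        ParamEnd.crossing, DeltaEdge.dual, Equiv.symm_mk, Equiv.coe_fn_mk, Matrix.of_apply,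
        GammaEdge.rowTwist, GammaEdge.colTwist, Units.val_mul, mul_pow, hu,
        posRep_one_sub_sub_one, add_sub_cancel, sub_add_cancel, sub_sub_cancel, sub_right_inj,
        if_true, and_self]
    · rcases eq_or_ne a c with rfl | hac
      · simp only [and_self, if_true]
        field_simp
        ring
      · have hpow := pow_val_sub_mul_pow_posRep (u : ℂ) a c
        have hne := posRep_injective.ne hac
        simp only [hac, hac.symm, if_false, false_and]
        field_simp
        grind
    · rw [pow_sub₀ _ hu0 (posRep_le c), hu]
      field_simp
    · field_simp
    · field_simp
      ring
  · rintro ⟨a | _, b | _⟩ h <;>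
      simp only [RGammaDelta, RGammaGamma, weightGammaDelta, weightGammaGamma, ParamEnd.twist,
        ParamEnd.crossing, DeltaEdge.dual, Equiv.symm_mk, Equiv.coe_fn_mk, Matrix.of_apply,
        GammaEdge.rowTwist, GammaEdge.colTwist, Units.val_mul, mul_pow, hu, sub_sub_eq_add_sub,
        Set.mem_range, Prod.mk.injEq, exists_eq_left, DeltaEdge.minus.injEq, if_true, and_self,
        not_true_eq_false] at h ⊢ <;>
      field_simp <;> grind

theorem ddagger_RGammaDelta_eq_twist_crossing [NeZero n] {v : ℂ} (hv : v ≠ 0) (g : ZMod n → ℂ)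
    {u : ℂˣ} (hu : (u : ℂ) ^ n = v) :
    ddagger (RGammaDelta v g) =
      (ParamEnd.crossing u⁻¹ DeltaEdge.dual.symm (ddagger (RDeltaDelta v g))).twist
        (DeltaEdge.rowTwist v u) (DeltaEdge.colTwist u) := by
  funext z₁ z₂
  have hu0 := u.ne_zero
  refine (ddagger_diagonalOutside DeltaEdge.dual (RGammaDelta_diagonalOutside v g) z₁ z₂).ext
    (ParamEnd.diagonalOutside_twist_crossing (ddagger_RDeltaDelta_apply_eq_zero v g)
      _ _ _ _ _ _) ?_ ?_
  · rintro (d | _) (b | _) <;>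
      simp only [ddagger_apply, RGammaDelta, RDeltaDelta, weightGammaDelta, weightDeltaDelta,
        ParamEnd.twist, ParamEnd.crossing, DeltaEdge.dual, Equiv.symm_mk, Equiv.coe_fn_mk,
        Matrix.of_apply, DeltaEdge.rowTwist, DeltaEdge.colTwist, Units.val_mul, mul_pow,
        Prod.swap_prod_mk, posRep_one_sub, add_sub_cancel, sub_add_cancel, sub_sub_cancel,
        sub_right_inj, Units.val_inv_eq_inv_val, inv_pow, hu, if_true, and_self,
        sub_sub_sub_cancel_left]
    · rcases eq_or_ne b d with rfl | hbd
      · simp only [and_self, if_true]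
        field_simp
        ring
      · have hpow := pow_val_sub_mul_pow_posRep (u : ℂ) b d
        have hne := posRep_injective.ne hbd
        have hle := posRep_le d
        have hval : (d - b).val = n - (b - d).val := by
          rw [← neg_sub, ZMod.neg_val, if_neg (sub_ne_zero.2 hbd)]
        rw [hval, Nat.sub_sub_self (b - d).val_lt.le]
        have hlt : n + 1 - posRep d < n + 1 - posRep b ↔ posRep b < posRep d := by lia
        simp only [hbd, hbd.symm, if_false, false_and, hlt]
        field_simp
        grind
    · rw [Nat.sub_add_comm (posRep_le d), pow_succ (u : ℂ), pow_sub₀ _ hu0 (posRep_le d), hu]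
      field_simp
    · rw [Nat.sub_add_comm (posRep_le b), pow_sub₀ (u : ℂ) hu0 (posRep_pos b), pow_one]
      field_simp
    · field_simp
      ring
  · rintro ⟨a | _, b | _⟩ h <;>
      simp only [ddagger_apply, RGammaDelta, RDeltaDelta, weightGammaDelta, weightDeltaDelta,
        ParamEnd.twist, ParamEnd.crossing, DeltaEdge.dual, Equiv.symm_mk, Equiv.coe_fn_mk,
        Matrix.of_apply, DeltaEdge.rowTwist, DeltaEdge.colTwist, Units.val_mul, mul_pow, hu,
        sub_sub_eq_add_sub, Set.mem_range, Prod.mk.injEq, exists_eq_left, GammaEdge.plus.injEq,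
        if_true, and_self, not_true_eq_false, Prod.swap_prod_mk, Units.val_inv_eq_inv_val,
        inv_pow, add_comm] at h ⊢ <;>
      field_simp <;> grind

end GammaDelta

/-! ### The inverse of `R^{ΔΓ}` -/

section Unitarity

theorem sum_range_ite_mul_sub_succ {R : Type*} [CommRing R] (b : ℕ → R) (y c : R) {k N : ℕ}
    (hk : k < N) :
    ∑ m ∈ Finset.range N, (if k < m then y else c) * (b m - b (m + 1)) =
      c * (b 0 - b (k + 1)) + y * (b (k + 1) - b N) := by
  induction N, hk using Nat.le_induction with
  | base =>
    rw [← Finset.sum_range_sub', sub_self, mul_zero, add_zero, Finset.mul_sum]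
    exact Finset.sum_congr rfl fun m hm => by
      rw [if_neg (Nat.lt_succ_iff.1 (Finset.mem_range.1 hm)).not_gt]
  | succ N hN ih =>
    rw [Finset.sum_range_succ, ih, if_pos (Nat.lt_of_succ_le hN)]
    ring

variable {K : Type*} [Field K]

/-- The entries of `(R^{ΓΔ})^‡` between the vectors `k ⊗ dual k`, indexed by ranks and up to
diagonal factors; `x` and `y` stand for `z₁ ^ n` and `z₂ ^ n`. -/
def crossingEntry (v x y : K) (m i : ℕ) : K :=
  if m = i then if m = 0 then v * (x - y) else y - v ^ 2 * x
  else (1 - v) * if m < i then y else v * x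

/-- The weights whose differences, used as multipliers of the rows of `crossingEntry`, make its
column sums telescope. -/
def telescopingWeight (v : K) : ℕ → K
  | 0 => 1
  | m + 1 => v ^ m * v⁻¹

/-- The entries of `R^{ΔΓ}` between the vectors `k ⊗ dual k`, with the conventions of
`crossingEntry`. -/
def inverseCrossingEntry (v x y : K) (n k m : ℕ) : K :=
  (if k = 0 then -v⁻¹ else 1) *
    ((if m = k then y - v ^ n * x else 0) -
      (telescopingWeight v (k + 1))⁻¹ * (telescopingWeight v m - telescopingWeight v (m + 1)) *
        if k < m then y else v ^ n * x)

theorem telescopingWeight_sub_mul_crossingEntry {v : K} (hv : v ≠ 0) (x y : K) (m i : ℕ) :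
    (telescopingWeight v m - telescopingWeight v (m + 1)) * crossingEntry v x y m i =
      (1 - v) * (telescopingWeight v m * (if m ≤ i then y else v * x) -
        telescopingWeight v (m + 1) * if m + 1 ≤ i then y else v * x) := by
  rcases lt_trichotomy m i with h | rfl | h
  · simp only [crossingEntry, h.ne, h, h.le, Nat.succ_le_of_lt h, if_true, if_false]
    ring
  · cases m with
    | zero =>
      simp only [crossingEntry, telescopingWeight, le_refl, Nat.not_succ_le_self, if_true,
        if_false, pow_zero]
      field_simp
      ring
    | succ m =>
      simp only [crossingEntry, telescopingWeight, le_refl, Nat.not_succ_le_self, if_true,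
        if_false, Nat.succ_ne_zero, pow_succ]
      field_simp
  · simp only [crossingEntry, h.ne', h.not_gt, h.not_ge, (Nat.lt_succ_of_lt h).not_ge, if_false]
    ring

theorem sum_telescopingWeight_sub_mul_crossingEntry {v : K} (hv : v ≠ 0) (x y : K) {n k i : ℕ}
    (hk : k ≤ n) (hi : i ≤ n) :
    ∑ m ∈ Finset.range (n + 1), (telescopingWeight v m - telescopingWeight v (m + 1)) *
        (if k < m then y else v ^ n * x) * crossingEntry v x y m i =
      telescopingWeight v (k + 1) * (y - v ^ n * x) *
        ((1 - v) * if k + 1 ≤ i then y else v * x) := by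
  have htelescope := sum_range_ite_mul_sub_succ
    (fun m => telescopingWeight v m * if m ≤ i then y else v * x) y (v ^ n * x)
    (Nat.lt_succ_of_le hk)
  calc _ = (1 - v) * ∑ m ∈ Finset.range (n + 1), (if k < m then y else v ^ n * x) *
        (telescopingWeight v m * (if m ≤ i then y else v * x) -
          telescopingWeight v (m + 1) * if m + 1 ≤ i then y else v * x) := by
        rw [Finset.mul_sum]
        exact Finset.sum_congr rfl fun m _ => by
          linear_combination (if k < m then y else v ^ n * x) *
            telescopingWeight_sub_mul_crossingEntry hv x y m i
    _ = _ := by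
        rw [htelescope]
        simp only [telescopingWeight, zero_le, if_true, (Nat.lt_succ_of_le hi).not_ge, if_false]
        field_simp
        ring

theorem sum_inverseCrossingEntry_mul_crossingEntry {v : K} (hv : v ≠ 0) (x y : K) {n k i : ℕ}
    (hk : k ≤ n) (hi : i ≤ n) :
    ∑ m ∈ Finset.range (n + 1), inverseCrossingEntry v x y n k m * crossingEntry v x y m i =
      if k = i then (y - v * x) * (y - v ^ n * x) else 0 := by
  have hweight : telescopingWeight v (k + 1) ≠ 0 := by simp [telescopingWeight, hv]
  have hsplit (m : ℕ) : inverseCrossingEntry v x y n k m * crossingEntry v x y m i =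
      (if k = 0 then -v⁻¹ else 1) *
        ((if m = k then (y - v ^ n * x) * crossingEntry v x y m i else 0) -
          (telescopingWeight v (k + 1))⁻¹ *
            ((telescopingWeight v m - telescopingWeight v (m + 1)) *
              (if k < m then y else v ^ n * x) * crossingEntry v x y m i)) := by
    rw [inverseCrossingEntry, ← ite_zero_mul]
    ring
  calc _ = (if k = 0 then -v⁻¹ else 1) * (y - v ^ n * x) *
        (crossingEntry v x y k i - (1 - v) * if k + 1 ≤ i then y else v * x) := by
        simp only [hsplit, ← Finset.mul_sum, Finset.sum_sub_distrib, Finset.sum_ite_eq',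
          Finset.mem_range, Nat.lt_succ_of_le hk, if_true,
          sum_telescopingWeight_sub_mul_crossingEntry hv x y hk hi]
        field_simp
    _ = _ := by
        rcases lt_trichotomy k i with h | rfl | h
        · simp only [crossingEntry, h.ne, h, Nat.succ_le_of_lt h, if_true, if_false]
          ring
        · rcases eq_or_ne k 0 with rfl | hk0
          · simp only [crossingEntry, if_true, Nat.not_succ_le_self, if_false]
            field_simp
            ring
          · simp only [crossingEntry, hk0, if_true, Nat.not_succ_le_self, if_false]
            ring
        · simp only [crossingEntry, h.ne', h.not_gt, (Nat.lt_succ_of_lt h).not_ge, if_false]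
          ring

theorem telescopingWeight_sub_succ {v : K} {m : ℕ} (hm : 0 < m) :
    telescopingWeight v m - telescopingWeight v (m + 1) = (1 - v) * (v ^ (m - 1) * v⁻¹) := by
  obtain ⟨m, rfl⟩ := Nat.exists_eq_add_of_lt hm
  simp only [telescopingWeight, zero_add, Nat.add_sub_cancel, pow_succ]
  ring

end Unitarity

section DeltaGamma

variable {n : ℕ}

theorem ddagger_RGammaDelta_apply_dual [NeZero n] {v : ℂ} (hv : v ≠ 0) (g : ZMod n → ℂ)
    (z₁ z₂ : ℂˣ) (k i : DeltaEdge n) :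
    ddagger (RGammaDelta v g) z₁ z₂ (k, k.dual) (i, i.dual) =
      k.dual.rowTwist (z₂ / z₁) * i.dual.colTwist v (z₂ / z₁) *
        crossingEntry v ((z₁ : ℂ) ^ n) ((z₂ : ℂ) ^ n) k.dual.rank i.dual.rank := by
  obtain ⟨k, rfl⟩ := DeltaEdge.dual.symm.surjective k
  obtain ⟨i, rfl⟩ := DeltaEdge.dual.symm.surjective i
  simp only [Equiv.apply_symm_apply]
  have h₁ := z₁.ne_zero
  have h₂ := z₂.ne_zero
  rcases k with c | _ <;> rcases i with a | _ <;>
    simp only [ddagger_apply, RGammaDelta, weightGammaDelta, Matrix.of_apply, DeltaEdge.dual,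
      Equiv.symm_mk, Equiv.coe_fn_mk, Prod.swap_prod_mk, GammaEdge.rowTwist, GammaEdge.colTwist,
      GammaEdge.rank, crossingEntry, posRep_one_sub_sub_one, Units.val_div_eq_div_val, div_pow,
      add_sub_cancel, sub_add_cancel, sub_right_inj, posRep_injective.eq_iff, if_true,
      (posRep_pos _).ne', (posRep_pos _).ne, posRep_pos, Nat.not_lt_zero, and_self, if_false]
  · rcases eq_or_ne a c with rfl | hac
    · simp only [if_true]
      field_simp
      ring
    · have hpow := pow_val_sub_mul_pow_sub_val_sub h₁ h₂ hac
      simp only [hac, hac.symm, if_false]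
      field_simp at hpow ⊢
      grind
  · rw [pow_sub₀ _ h₁ (posRep_le c)]
    field_simp
  · rw [pow_sub₀ _ h₂ (posRep_le a)]
    field_simp
  · field_simp
    ring

theorem RDeltaGamma_apply_dual [NeZero n] {v : ℂ} (hv : v ≠ 0) (g : ZMod n → ℂ)
    (z₁ z₂ : ℂˣ) (k i : DeltaEdge n) :
    RDeltaGamma v g z₁ z₂ (k, k.dual) (i, i.dual) =
      (k.dual.colTwist v (z₂ / z₁) * i.dual.rowTwist (z₂ / z₁))⁻¹ *
        inverseCrossingEntry v ((z₁ : ℂ) ^ n) ((z₂ : ℂ) ^ n) n k.dual.rank i.dual.rank := by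
  obtain ⟨k, rfl⟩ := DeltaEdge.dual.symm.surjective k
  obtain ⟨i, rfl⟩ := DeltaEdge.dual.symm.surjective i
  simp only [Equiv.apply_symm_apply]
  have h₁ := z₁.ne_zero
  have h₂ := z₂.ne_zero
  rcases k with c | _ <;> rcases i with a | _ <;>
    simp only [RDeltaGamma, weightDeltaGamma, Matrix.of_apply, DeltaEdge.dual,
      Equiv.symm_mk, Equiv.coe_fn_mk, GammaEdge.rowTwist, GammaEdge.colTwist,
      GammaEdge.rank, inverseCrossingEntry, posRep_one_sub_sub_one, Units.val_div_eq_div_val,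
      div_pow, add_sub_cancel, sub_add_cancel, sub_right_inj, posRep_injective.eq_iff, if_true,
      (posRep_pos _).ne', (posRep_pos _).ne, posRep_pos, Nat.not_lt_zero, and_self, if_false]
  · rcases eq_or_ne a c with rfl | hac
    · rw [telescopingWeight_sub_succ (posRep_pos a)]
      simp only [if_true, telescopingWeight, lt_irrefl, if_false,
        ← pow_sub_one_mul (posRep_pos a).ne' v, ← pow_sub_one_mul (NeZero.ne n) v]
      field_simp
      ring
    · have hpow := pow_val_sub_mul_pow_sub_val_sub (mul_ne_zero hv h₁) h₂ hac
      have hval : (a - c).val ≠ 0 := (ZMod.val_ne_zero _).2 (sub_ne_zero.2 hac)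
      rw [telescopingWeight_sub_succ (posRep_pos a)]
      simp only [mul_pow, ← pow_sub_one_mul hval v, ← pow_sub_one_mul (posRep_pos a).ne' v] at hpow
      simp only [hac, if_false, telescopingWeight, sub_sub_sub_cancel_left]
      field_simp at hpow ⊢
      grind
  · simp only [telescopingWeight, pow_sub₀ _ h₁ (posRep_le c), pow_sub₀ _ hv (posRep_le c)]
    field_simp
    ring
  · rw [telescopingWeight_sub_succ (posRep_pos a), pow_sub₀ _ h₂ (posRep_le a)]
    simp only [telescopingWeight]
    field_simp
    ring
  · simp only [telescopingWeight]
    field_simp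
    ring

namespace GammaEdge

theorem rowTwist_ne_zero (u : ℂˣ) (e : GammaEdge n) : e.rowTwist u ≠ 0 := by
  cases e <;> simp [rowTwist]

theorem colTwist_ne_zero {v : ℂ} (hv : v ≠ 0) (u : ℂˣ) (e : GammaEdge n) :
    e.colTwist v u ≠ 0 := by
  cases e <;> simp [colTwist, hv]

variable [NeZero n]

theorem rank_le (e : GammaEdge n) : e.rank ≤ n := by
  cases e
  · exact posRep_le _
  · exact n.zero_le

theorem sum_rank {M : Type*} [AddCommMonoid M] (f : ℕ → M) :
    ∑ e : GammaEdge n, f e.rank = ∑ m ∈ Finset.range (n + 1), f m := by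
  refine Finset.sum_bij (fun e _ => e.rank) (fun e _ => Finset.mem_range_succ_iff.2 e.rank_le)
    (fun _ _ _ _ h => rank_injective h) (fun m hm => ?_) fun _ _ => rfl
  rcases m.eq_zero_or_pos with rfl | hpos
  · exact ⟨.minus, Finset.mem_univ _, rfl⟩
  · exact ⟨.plus m, Finset.mem_univ _, posRep_natCast hpos (Finset.mem_range_succ_iff.1 hm)⟩

end GammaEdge

theorem RDeltaGamma_diagonalOutside (v : ℂ) (g : ZMod n → ℂ) (z₁ z₂ : ℂˣ) :
    DiagonalOutside (fun k => (k, DeltaEdge.dual k)) (RDeltaGamma v g z₁ z₂) := by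
  rintro ⟨c | _, d | _⟩ ⟨a | _, b | _⟩ hne hentry <;>
    simp only [RDeltaGamma, weightDeltaGamma, Matrix.of_apply, DeltaEdge.dual,
      Equiv.coe_fn_mk, Set.mem_range, Prod.mk.injEq] at hne hentry ⊢ <;>
    grind

section CrossingUnitarity

variable [NeZero n] {v : ℂ} (hv : v ≠ 0)
include hv

theorem sum_RDeltaGamma_mul_ddagger_RGammaDelta_dual (g : ZMod n → ℂ) (z₁ z₂ : ℂˣ)
    (k i : DeltaEdge n) :
    ∑ m : DeltaEdge n, RDeltaGamma v g z₁ z₂ (k, k.dual) (m, m.dual) *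
        ddagger (RGammaDelta v g) z₁ z₂ (m, m.dual) (i, i.dual) =
      if k = i then ((z₂ : ℂ) ^ n - v * z₁ ^ n) * (z₂ ^ n - v ^ n * z₁ ^ n) else 0 := by
  let entry (m : ℕ) : ℂ := inverseCrossingEntry v ((z₁ : ℂ) ^ n) ((z₂ : ℂ) ^ n) n k.dual.rank m *
    crossingEntry v ((z₁ : ℂ) ^ n) ((z₂ : ℂ) ^ n) m i.dual.rank
  calc
    _ = ∑ m : DeltaEdge n, (k.dual.colTwist v (z₂ / z₁))⁻¹ * i.dual.colTwist v (z₂ / z₁) *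
          entry m.dual.rank := by
        refine Finset.sum_congr rfl fun m _ => ?_
        rw [RDeltaGamma_apply_dual hv, ddagger_RGammaDelta_apply_dual hv]
        have hm := m.dual.rowTwist_ne_zero (z₂ / z₁)
        simp only [entry]
        field_simp
    _ = (k.dual.colTwist v (z₂ / z₁))⁻¹ * i.dual.colTwist v (z₂ / z₁) *
          ∑ m ∈ Finset.range (n + 1), entry m := by
        rw [← Finset.mul_sum, DeltaEdge.dual.sum_comp fun e => entry e.rank, GammaEdge.sum_rank]
    _ = _ := by
        rw [sum_inverseCrossingEntry_mul_crossingEntry hv _ _ k.dual.rank_le i.dual.rank_le]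
        simp only [GammaEdge.rank_injective.eq_iff, EmbeddingLike.apply_eq_iff_eq]
        split_ifs with hki
        · rw [hki, inv_mul_cancel₀ (i.dual.colTwist_ne_zero hv _), one_mul]
        · rw [mul_zero]

variable {g : ZMod n → ℂ} (hg : ∀ a ≠ 0, g (-a) * g a = v)
include hg

theorem RDeltaGamma_mul_ddagger_RGammaDelta_of_notMem (z₁ z₂ : ℂˣ)
    {p : DeltaEdge n × GammaEdge n} (hp : p ∉ Set.range fun k => (k, DeltaEdge.dual k)) :
    RDeltaGamma v g z₁ z₂ p p * ddagger (RGammaDelta v g) z₁ z₂ p p =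
      (z₂ ^ n - v * z₁ ^ n) * (z₂ ^ n - v ^ n * z₁ ^ n) := by
  rcases p with ⟨a | _, b | _⟩ <;>
    simp only [ddagger_apply, RGammaDelta, RDeltaGamma, weightGammaDelta, weightDeltaGamma,
      Matrix.of_apply, Prod.swap_prod_mk, if_true, and_self]
  · have hab : a + b ≠ 1 := fun h => hp ⟨.minus a, by simp [DeltaEdge.dual, ← h]⟩
    have hgab : g (a + b - 1) ≠ 0 :=
      right_ne_zero_of_mul (hg _ (sub_ne_zero.2 hab) ▸ hv)
    simp only [add_comm b a, hab, if_false]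
    field_simp
  · ring
  · ring
  · exact absurd ⟨.plus, rfl⟩ hp

theorem RDeltaGamma_mul_ddagger_RGammaDelta (z₁ z₂ : ℂˣ) :
    RDeltaGamma v g z₁ z₂ * ddagger (RGammaDelta v g) z₁ z₂ =
      (((z₂ : ℂ) ^ n - v * z₁ ^ n) * (z₂ ^ n - v ^ n * z₁ ^ n)) • 1 :=
  (RDeltaGamma_diagonalOutside v g z₁ z₂).mul_eq_smul_one
    (ddagger_diagonalOutside _ (RGammaDelta_diagonalOutside v g) z₁ z₂)
    (fun _ _ h => congrArg Prod.fst h)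
    (sum_RDeltaGamma_mul_ddagger_RGammaDelta_dual hv g z₁ z₂)
    fun _ => RDeltaGamma_mul_ddagger_RGammaDelta_of_notMem hv hg z₁ z₂

end CrossingUnitarity

theorem ne_of_isUnit_RDeltaGamma [NeZero n] {v : ℂ} {g : ZMod n → ℂ} {z₁ z₂ : ℂˣ}
    (h : IsUnit (RDeltaGamma v g z₁ z₂)) : (z₂ : ℂ) ^ n ≠ v ^ n * z₁ ^ n := fun hz => by
  refine ((Matrix.isUnit_iff_isUnit_det _).1 h).ne_zero
    (Matrix.det_eq_zero_of_column_eq_zero (DeltaEdge.plus, GammaEdge.plus 0) fun p => ?_)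
  by_contra hentry
  rcases eq_or_ne p (.plus, .plus 0) with rfl | hp
  · simp [RDeltaGamma, weightDeltaGamma, hz] at hentry
  · obtain ⟨-, k, hk⟩ := RDeltaGamma_diagonalOutside v g z₁ z₂ _ _ hp hentry
    cases k <;> simp [DeltaEdge.dual] at hk

section Inverse

variable [NeZero n] {v : ℂ} (hv : v ≠ 0) {g : ZMod n → ℂ} (hg : ∀ a ≠ 0, g (-a) * g a = v)
  (z₁ z₂ : ℂˣ)
include hv hg

theorem isUnit_RDeltaGamma_iff :
    IsUnit (RDeltaGamma v g z₁ z₂) ↔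
      ((z₂ : ℂ) ^ n - v * z₁ ^ n) * (z₂ ^ n - v ^ n * z₁ ^ n) ≠ 0 := by
  have hmul := RDeltaGamma_mul_ddagger_RGammaDelta hv hg z₁ z₂
  refine ⟨fun h hc => ?_, fun hc => IsUnit.of_mul_eq_one _ <| by
    rw [← inv_smul_eq_iff₀ hc, ← Matrix.mul_smul] at hmul
    exact hmul⟩
  have hne := ne_of_isUnit_RDeltaGamma h
  have hz : (z₂ : ℂ) ^ n = v * z₁ ^ n :=
    sub_eq_zero.1 ((mul_eq_zero.1 hc).resolve_right (sub_ne_zero.2 hne))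
  rw [hc, zero_smul, h.mul_right_eq_zero] at hmul
  have hentry : (z₂ : ℂ) ^ n - z₁ ^ n = 0 := by
    simpa [ddagger_apply, RGammaDelta, weightGammaDelta] using
      congrFun₂ hmul (.plus, .minus) (.plus, .minus)
  have hv1 : v = 1 := by
    have hz₁ := pow_ne_zero n z₁.ne_zero
    grind
  exact hne (by rw [hz, hv1, one_pow])

/- Both sides vanish when `R^{ΔΓ}` is singular, the inverses being junk values there. -/
theorem inv_RDeltaGamma :
    (RDeltaGamma v g z₁ z₂)⁻¹ =
      (((z₂ : ℂ) ^ n - v * z₁ ^ n) * (z₂ ^ n - v ^ n * z₁ ^ n))⁻¹ •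
        ddagger (RGammaDelta v g) z₁ z₂ := by
  by_cases hc : ((z₂ : ℂ) ^ n - v * z₁ ^ n) * (z₂ ^ n - v ^ n * z₁ ^ n) = 0
  · have hsing := mt (isUnit_RDeltaGamma_iff hv hg z₁ z₂).1 (not_not.2 hc)
    rw [Matrix.isUnit_iff_isUnit_det] at hsing
    rw [hc, inv_zero, zero_smul, Matrix.nonsing_inv_apply_not_isUnit _ hsing]
  · refine Matrix.inv_eq_right_inv ?_
    rw [Matrix.mul_smul, RDeltaGamma_mul_ddagger_RGammaDelta hv hg, inv_smul_smul₀ hc]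

theorem ddagger_inv_RDeltaGamma :
    ddagger (fun z₁ z₂ => (RDeltaGamma v g z₁ z₂)⁻¹) z₁ z₂ =
      (((z₁ : ℂ) ^ n - v * z₂ ^ n) * (z₁ ^ n - v ^ n * z₂ ^ n))⁻¹ • RGammaDelta v g z₁ z₂ := by
  ext p q
  simp only [ddagger_apply, inv_RDeltaGamma hv hg, Matrix.smul_apply, Prod.swap_swap]

end Inverse

end DeltaGamma

/-! ### The Yang-Baxter system -/

theorem exists_unit_pow_eq {K : Type*} [Field K] [IsAlgClosed K] {v : K} (hv : v ≠ 0) {n : ℕ}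
    (hn : n ≠ 0) : ∃ u : Kˣ, (u : K) ^ n = v := by
  obtain ⟨u, hu⟩ := IsAlgClosed.exists_pow_nat_eq v (Nat.pos_of_ne_zero hn)
  exact ⟨.mk0 u fun h0 => hv (by rw [← hu, h0, zero_pow hn]), hu⟩

section MixedYangBaxter

variable {n : ℕ} [NeZero n] {v : ℂ} (hv : v ≠ 0) {g : ZMod n → ℂ} (hg : ∀ a ≠ 0, g (-a) * g a = v)
include hv hg

theorem RGammaGamma_RGammaDelta_satisfiesYBE :
    SatisfiesYBE (RGammaGamma v g) (RGammaDelta v g) (RGammaDelta v g) := by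
  obtain ⟨u, hu⟩ := exists_unit_pow_eq hv (NeZero.ne n)
  rw [RGammaDelta_eq_twist_crossing hv g hu]
  exact (RGammaGamma_satisfiesYBE hg).twist_crossing (RGammaGamma_apply_eq_zero v g) _ _ _ _

theorem ddagger_RDeltaDelta_ddagger_RGammaDelta_satisfiesYBE :
    SatisfiesYBE (ddagger (RDeltaDelta v g)) (ddagger (RGammaDelta v g))
      (ddagger (RGammaDelta v g)) := by
  obtain ⟨u, hu⟩ := exists_unit_pow_eq hv (NeZero.ne n)
  rw [ddagger_RGammaDelta_eq_twist_crossing hv g hu]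
  exact (ddagger_RDeltaDelta_satisfiesYBE hg).twist_crossing
    (ddagger_RDeltaDelta_apply_eq_zero v g) _ _ _ _

end MixedYangBaxter

theorem mainTheorem3 (n : ℕ) [NeZero n] (v : ℂ) (hv : v ≠ 0) (g : ZMod n → ℂ)
    (hg0 : g 0 = -v) (hg : ∀ a : ZMod n, a ≠ 0 → g (-a) * g a = v) :
    IsYangBaxterSystem (RGammaGamma v g) (fun z₁ z₂ => (RDeltaGamma v g z₁ z₂)⁻¹)
        (RGammaDelta v g) (ddagger (RDeltaDelta v g)) ∧
      (∃ c : ℂˣ → ℂˣ → ℂ, ∀ z₁ z₂ : ℂˣ, IsUnit (RDeltaGamma v g z₁ z₂) →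
        c z₁ z₂ ≠ 0 ∧
          ddagger (RGammaDelta v g) z₁ z₂ = c z₁ z₂ • (RDeltaGamma v g z₁ z₂)⁻¹) ∧
      (∀ z₁ z₂ : ℂˣ, (z₂ : ℂ) ^ n ≠ v ^ n * (z₁ : ℂ) ^ n → (z₂ : ℂ) ^ n ≠ v * (z₁ : ℂ) ^ n →
        IsUnit (RDeltaGamma v g z₁ z₂)) := by
  have hAC := RGammaGamma_RGammaDelta_satisfiesYBE hv hg
  have hDC := ddagger_RDeltaDelta_ddagger_RGammaDelta_satisfiesYBE hv hg
  have hB := funext₂ (inv_RDeltaGamma hv hg)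
  have hB' := funext₂ (ddagger_inv_RDeltaGamma hv hg)
  have hc := isUnit_RDeltaGamma_iff hv hg
  refine ⟨⟨RGammaGamma_satisfiesYBE hg, hAC, ?_, ?_, ddagger_RDeltaDelta_satisfiesYBE hg, ?_,
      hDC, ?_⟩,
    ⟨fun z₁ z₂ => (z₂ ^ n - v * z₁ ^ n) * (z₂ ^ n - v ^ n * z₁ ^ n), fun z₁ z₂ h =>
      ⟨(hc z₁ z₂).1 h, by rw [inv_RDeltaGamma hv hg, smul_inv_smul₀ ((hc z₁ z₂).1 h)]⟩⟩,
    fun z₁ z₂ h h' => (hc z₁ z₂).2 (mul_ne_zero (sub_ne_zero.2 h') (sub_ne_zero.2 h))⟩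
  · exact hB' ▸ (hAC.smul_left _).smul_right _
  · exact hB' ▸ hAC.smul_right _
  · exact hB ▸ (hDC.smul_left _).smul_right _
  · exact hB ▸ hDC.smul_left _
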